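/- Let $n\ge 1$ and let $S_n$ be the symmetric group on $\{1,\dots,n\}$, with products of permutations being compositions of functions and $w_j=w(j)$. Let $s_i=(i\;\,i{+}1)$ for $1\le i\le n-1$, let $\ell(w)$ be the smallest $k$ such that $w$ is a product of $k$ of the $s_i$, and let $w_0=n,n-1,\dots,1$ in one-line notation. The strong Bruhat order has the covering relations: $w\lessdot v$ if and only if $v=wt$ for some transposition $t=(i\;j)$ and $\ell(v)=\ell(w)+1$. The (Lehmer) code of $w$ is $\mathrm{code}(w)=(c_1,\dots,c_{n-1})$ with $c_i=\#\{j>i : w_j<w_i\}$. The Schubert polynomials $\mathfrak S_w$ ($w\in S_n$) are the polynomials over $\mathbb C$ determined by $$\mathfrak S_{w_0}=x_1^{n-1}x_2^{n-2}\cdots x_{n-1},\qquad \mathfrak S_{s_iw}=\frac{\mathfrak S_w-s_i\cdot\mathfrak S_w}{x_i-x_{i+1}}\quad\text{if }\ell(s_iw)<\ell(w),$$ where $s_i$ acts on polynomials by interchanging $x_i$ and $x_{i+1}$. Let $\rho=(n-1,n-2,\dots,1)$. Every $\mathfrak S_w$ is a linear combination of the monomials $x^\alpha=x_1^{\alpha_1}\cdots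 x_{n-1}^{\alpha_{n-1}}$ with $\alpha\le\rho$ componentwise; the padded Schubert polynomial $\tilde{\mathfrak S}_w(x_1,\dots,x_{n-1};y_1,\dots,y_{n-1})$ is the image of $\mathfrak S_w$ under the linear map $x^\alpha\mapsto x^\alpha y^{\rho-\alpha}$. Let $\tilde V=\mathrm{span}_{\mathbb C}\{x^\alpha y^{\rho-\alpha} : \alpha\le\rho\}$ and $\Delta=\sum_{i=1}^{n-1}x_i\,\frac{\partial}{\partial y_i}$. **Theorem.** The padded Schubert polynomials $\tilde{\mathfrak S}_w$, $w\in S_n$, form a basis of $\tilde V$ (so that $\tilde V$ is identified with $\mathbb C S_n$ by $\tilde{\mathfrak S}_w\mapsto w$), and $\Delta$ acts on this basis as an order-raising operator for the strong Bruhat order: for every $w\in S_n$, $$\Delta\cdot\tilde{\mathfrak S}_w=\sum_{u\in S_n:\ w\lessdot wu}c(w,wu)\,\tilde{\mathfrak S}_{wu},$$ where $c(w,wu)$ is the Manhattan distance $\sum_{i=1}^{n-1}|\mathrm{code}(w)_i-\mathrm{code}(wu)_i|$ between the codes of $w$ and $wu$. -/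

import Mathlib

namespace PaddedSchubert

open MvPolynomial Equiv

/-! Indices start at `0`: an index `i` here stands for `i + 1` in the usual notation.
A permutation `w : Equiv.Perm (Fin n)` has one-line notation `w 0, w 1, …`, and products of
permutations are compositions of functions: `(u * v) j = u (v j)`. -/

/-- The index `i` as one of the `n` letters. -/
def lo {n : ℕ} (i : Fin (n - 1)) : Fin n := ⟨i, by omega⟩

/-- The index `i + 1` as one of the `n` letters. -/
def hi {n : ℕ} (i : Fin (n - 1)) : Fin n := ⟨i + 1, by omega⟩

/-- The simple transposition `s_i = (i, i+1)`. -/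
def simpleTransposition {n : ℕ} (i : Fin (n - 1)) : Perm (Fin n) := swap (lo i) (hi i)

/-- The length of `w`: the smallest `k` such that `w` is a product of `k` simple transpositions. -/
noncomputable def length {n : ℕ} (w : Perm (Fin n)) : ℕ :=
  sInf {k | ∃ l : List (Fin (n - 1)), l.length = k ∧ w = (l.map simpleTransposition).prod}

/-- The covering relation of the strong Bruhat order: `w ⋖ v` if and only if `v = w t_{ij}` for
some transposition `t_{ij}` and `ℓ(v) = ℓ(w) + 1`. -/
def StrongCover {n : ℕ} (w v : Perm (Fin n)) : Prop :=
  (∃ i j : Fin n, i < j ∧ v = w * swap i j) ∧ length v = length w + 1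

/-- The Lehmer code `(c_1, …, c_{n-1})`, with `c_i` the number of `j > i` such that
`w_j < w_i`. -/
def code {n : ℕ} (w : Perm (Fin n)) (i : Fin (n - 1)) : ℕ :=
  (Finset.univ.filter fun j : Fin n => lo i < j ∧ w j < w (lo i)).card

/-- The Manhattan (`ℓ¹`) distance between the codes of `w` and `v`. -/
def codeDistance {n : ℕ} (w v : Perm (Fin n)) : ℤ :=
  ∑ i : Fin (n - 1), |(code w i : ℤ) - (code v i : ℤ)|

/-- The staircase `ρ = (n-1, n-2, …, 2, 1)`. -/
def staircase (n : ℕ) (i : Fin (n - 1)) : ℕ := n - 1 - i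

/-- The longest permutation `w₀ = n, n-1, …, 1`. -/
def longest (n : ℕ) : Perm (Fin n) := Fin.revPerm

/-! ### Divided differences -/

/-- `x_a - x_b` divides `g - (a b) ⬝ g`. -/
theorem sub_dvd_sub_rename_swap {n : ℕ} (a b : Fin n) (g : MvPolynomial (Fin n) ℂ) :
    (X a - X b : MvPolynomial (Fin n) ℂ) ∣ g - rename (swap a b) g := by
  induction g using MvPolynomial.induction_on with
  | C c => simp
  | add p q hp hq =>
    have := dvd_add hp hq
    rw [map_add]
    convert this using 1
    ring
  | mul_X p k hp =>
    have hk : (X a - X b : MvPolynomial (Fin n) ℂ) ∣ X k - X (swap a b k) := by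
      rw [swap_apply_def]
      split_ifs with h1 h2
      · subst h1; exact dvd_rfl
      · subst h2; exact ⟨-1, by ring⟩
      · simp
    have : p * X k - rename (swap a b) (p * X k)
        = (p - rename (swap a b) p) * X k + rename (swap a b) p * (X k - X (swap a b k)) := by
      rw [map_mul, rename_X]; ring
    rw [this]
    exact dvd_add (hp.mul_right _) (hk.mul_left _)

/-- The quotient `(g - (a b) ⬝ g) / (x_a - x_b)`, where the transposition `(a b)` acts by
interchanging `x_a` and `x_b`. -/
noncomputable def divDiff {n : ℕ} (a b : Fin n) (g : MvPolynomial (Fin n) ℂ) :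
    MvPolynomial (Fin n) ℂ :=
  (sub_dvd_sub_rename_swap a b g).choose

theorem divDiff_spec {n : ℕ} (a b : Fin n) (g : MvPolynomial (Fin n) ℂ) :
    (X a - X b) * divDiff a b g = g - rename (swap a b) g :=
  (sub_dvd_sub_rename_swap a b g).choose_spec.symm

/-- The `i`-th Newton divided difference operator
`N_i ⬝ g = (g - s_i ⬝ g) / (x_i - x_{i+1})`. -/
noncomputable def newton {n : ℕ} (i : Fin (n - 1)) (g : MvPolynomial (Fin n) ℂ) :
    MvPolynomial (Fin n) ℂ :=
  divDiff (lo i) (hi i) g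

/-! ### Schubert polynomials -/

/-- The recursive definition of the Schubert polynomials: `IsSchubert w g` says that `g` is
obtained as `𝔖_w` from the rules `𝔖_{w₀} = x^ρ` and
`𝔖_{s_i w} = N_i ⬝ 𝔖_w` if `ℓ(s_i w) < ℓ(w)`. -/
inductive IsSchubert {n : ℕ} : Perm (Fin n) → MvPolynomial (Fin n) ℂ → Prop
  | top : IsSchubert (longest n) (∏ i : Fin (n - 1), X (lo i) ^ staircase n i)
  | step {w : Perm (Fin n)} {g : MvPolynomial (Fin n) ℂ} (i : Fin (n - 1)) :
      IsSchubert w g → length (simpleTransposition i * w) < length w →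
        IsSchubert (simpleTransposition i * w) (newton i g)

/-! The recursive definition is consistent and reaches every permutation. -/

section WellDefined

theorem X_sub_X_ne_zero {n : ℕ} {a b : Fin n} (h : a ≠ b) :
    (X a - X b : MvPolynomial (Fin n) ℂ) ≠ 0 := by
  rw [sub_ne_zero]
  exact fun h' => h (X_injective h')

theorem rename_swap_swap {n : ℕ} (a b : Fin n) (g : MvPolynomial (Fin n) ℂ) :
    rename (swap a b) (rename (swap a b) g) = g := by
  rw [rename_rename]
  have : (⇑(swap a b) ∘ ⇑(swap a b)) = id := by funext x; simp
  rw [this, rename_id_apply]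

theorem rename_divDiff {n : ℕ} {a b : Fin n} (h : a ≠ b) (g : MvPolynomial (Fin n) ℂ) :
    rename (swap a b) (divDiff a b g) = divDiff a b g := by
  have h1 := congrArg (rename (swap a b)) (divDiff_spec a b g)
  simp only [map_mul, map_sub, rename_X, swap_apply_left, swap_apply_right,
    rename_swap_swap] at h1
  have h2 := divDiff_spec a b g
  apply mul_left_cancel₀ (X_sub_X_ne_zero h)
  linear_combination -h1 - h2

theorem divDiff_comm_neg {n : ℕ} {a b : Fin n} (h : a ≠ b) (g : MvPolynomial (Fin n) ℂ) :
    divDiff b a g = -divDiff a b g := by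
  have h1 := divDiff_spec a b g
  have h2 := divDiff_spec b a g
  rw [swap_comm b a] at h2
  apply mul_left_cancel₀ (X_sub_X_ne_zero h)
  linear_combination h1 - h2

theorem divDiff_neg {n : ℕ} {a b : Fin n} (h : a ≠ b) (g : MvPolynomial (Fin n) ℂ) :
    divDiff a b (-g) = -divDiff a b g := by
  have h1 := divDiff_spec a b g
  have h2 := divDiff_spec a b (-g)
  rw [map_neg] at h2
  apply mul_left_cancel₀ (X_sub_X_ne_zero h)
  linear_combination h1 + h2

theorem swap_commute {n : ℕ} {a b c d : Fin n} (hac : a ≠ c) (had : a ≠ d) (hbc : b ≠ c)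
    (hbd : b ≠ d) : Commute (swap a b) (swap c d) := by
  have hd : (swap a b).Disjoint (swap c d) := by
    intro x
    by_cases hx : x = c ∨ x = d
    · left
      rcases hx with rfl | rfl
      · exact swap_apply_of_ne_of_ne hac.symm hbc.symm
      · exact swap_apply_of_ne_of_ne had.symm hbd.symm
    · right
      push Not at hx
      exact swap_apply_of_ne_of_ne hx.1 hx.2
  exact hd.commute

theorem swap_braid {n : ℕ} {a b c : Fin n} (hab : a ≠ b) (hbc : b ≠ c) (hac : a ≠ c) :
    swap a b * swap b c * swap a b = swap b c * swap a b * swap b c := by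
  have h1 := swap_mul_swap_mul_swap hab hac
  have h2 := swap_mul_swap_mul_swap hbc.symm hac.symm
  rw [h1, swap_comm a b, swap_comm b c, h2, swap_comm]

theorem divDiff_commute {n : ℕ} {a b c d : Fin n} (hab : a ≠ b) (hcd : c ≠ d) (hac : a ≠ c)
    (had : a ≠ d) (hbc : b ≠ c) (hbd : b ≠ d) (g : MvPolynomial (Fin n) ℂ) :
    divDiff a b (divDiff c d g) = divDiff c d (divDiff a b g) := by
  have key : rename (swap a b) (rename (swap c d) g) = rename (swap c d) (rename (swap a b) g) := by
    rw [rename_rename, rename_rename]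
    congr 2
    exact congrArg DFunLike.coe (swap_commute hac had hbc hbd).eq
  have h1 := divDiff_spec c d g
  have h2 := divDiff_spec a b (divDiff c d g)
  have h3 := divDiff_spec a b g
  have h4 := divDiff_spec c d (divDiff a b g)
  have h5 := congrArg (rename (swap a b)) h1
  have h6 := congrArg (rename (swap c d)) h3
  simp only [map_mul, map_sub, rename_X, swap_apply_of_ne_of_ne hac.symm hbc.symm,
    swap_apply_of_ne_of_ne had.symm hbd.symm, swap_apply_of_ne_of_ne hac had,
    swap_apply_of_ne_of_ne hbc hbd] at h5 h6
  apply mul_left_cancel₀ (X_sub_X_ne_zero hab)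
  apply mul_left_cancel₀ (X_sub_X_ne_zero hcd)
  rw [key] at h5
  linear_combination (X c - X d) * h2 - (X a - X b) * h4 + h1 - h5 - h3 + h6

theorem divDiff_triple {n : ℕ} {a b c : Fin n} (hab : a ≠ b) (hbc : b ≠ c) (hac : a ≠ c)
    (g : MvPolynomial (Fin n) ℂ) :
    (X a - X b) * (X b - X c) * (X a - X c) * divDiff a b (divDiff b c (divDiff a b g)) =
      g - rename (swap a b) g - rename (swap b c) g + rename (swap b c) (rename (swap a b) g)
        + rename (swap a b) (rename (swap b c) g)
        - rename (swap a b) (rename (swap b c) (rename (swap a b) g)) := by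
  have hσ := rename_divDiff hab g
  have h1 := divDiff_spec a b g
  set h := divDiff a b g
  have h2 := divDiff_spec b c h
  set k := divDiff b c h
  have h3 := divDiff_spec a b k
  have h4 := congrArg (rename (swap b c)) h1
  have h5 := congrArg (rename (swap a b)) h2
  simp only [map_mul, map_sub, rename_X, swap_apply_left, swap_apply_right,
    swap_apply_of_ne_of_ne hab hac, swap_apply_of_ne_of_ne hac.symm hbc.symm, hσ] at h4 h5
  have h6 := congrArg (rename (swap a b)) h4
  simp only [map_mul, map_sub, rename_X, swap_apply_left,
    swap_apply_of_ne_of_ne hac.symm hbc.symm] at h6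
  linear_combination (X b - X c) * (X a - X c) * h3 + (X a - X c) * h2 - (X b - X c) * h5 + h1
    - h4 + h6

theorem divDiff_braid {n : ℕ} {a b c : Fin n} (hab : a ≠ b) (hbc : b ≠ c) (hac : a ≠ c)
    (g : MvPolynomial (Fin n) ℂ) :
    divDiff a b (divDiff b c (divDiff a b g)) = divDiff b c (divDiff a b (divDiff b c g)) := by
  have h1 := divDiff_triple hab hbc hac g
  have h2 := divDiff_triple hbc.symm hab.symm hac.symm g
  have key : rename (swap a b) (rename (swap b c) (rename (swap a b) g))
      = rename (swap b c) (rename (swap a b) (rename (swap b c) g)) := by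
    simp only [rename_rename]
    congr 2
    exact congrArg DFunLike.coe (swap_braid hab hbc hac)
  rw [swap_comm c b, swap_comm b a, divDiff_comm_neg hbc, divDiff_comm_neg hbc,
    divDiff_comm_neg hab, divDiff_neg hbc, divDiff_neg hab, divDiff_neg hbc] at h2
  rw [key] at h1
  apply mul_left_cancel₀ (mul_ne_zero (mul_ne_zero (X_sub_X_ne_zero hab) (X_sub_X_ne_zero hbc))
    (X_sub_X_ne_zero hac))
  linear_combination h1 - h2

/-- The set of inversions of `w`. -/
def inversions {n : ℕ} (w : Perm (Fin n)) : Finset (Fin n × Fin n) :=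
  Finset.univ.filter fun p => p.1 < p.2 ∧ w p.2 < w p.1

theorem simpleTransposition_mul_self {n : ℕ} (i : Fin (n - 1)) :
    simpleTransposition i * simpleTransposition i = 1 := by
  simp [simpleTransposition]

theorem simpleTransposition_mul_cancel {n : ℕ} (i : Fin (n - 1)) (w : Perm (Fin n)) :
    simpleTransposition i * (simpleTransposition i * w) = w := by
  rw [← mul_assoc, simpleTransposition_mul_self, one_mul]

theorem lo_lt_hi {n : ℕ} (i : Fin (n - 1)) : lo i < hi i := by
  simp [lo, hi]

theorem simple_val {n : ℕ} (i : Fin (n - 1)) (x : Fin n) :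
    (simpleTransposition i x : ℕ) = if (x : ℕ) = (i : ℕ) then (i : ℕ) + 1 else
      if (x : ℕ) = (i : ℕ) + 1 then (i : ℕ) else (x : ℕ) := by
  simp only [simpleTransposition, swap_apply_def, lo, hi, Fin.ext_iff]
  split_ifs <;> simp

theorem card_inversions_of_ascent {n : ℕ} (i : Fin (n - 1)) (w : Perm (Fin n))
    (h : w⁻¹ (lo i) < w⁻¹ (hi i)) :
    (inversions (simpleTransposition i * w)).card = (inversions w).card + 1 := by
  have hlo : w (w⁻¹ (lo i)) = lo i := by simp
  have hhi : w (w⁻¹ (hi i)) = hi i := by simp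
  have : inversions (simpleTransposition i * w)
      = insert (w⁻¹ (lo i), w⁻¹ (hi i)) (inversions w) := by
    ext ⟨a, b⟩
    have ha : a = w⁻¹ (lo i) ↔ (w a : ℕ) = i := by
      rw [Perm.eq_inv_iff_eq, Fin.ext_iff]; rfl
    have hb : b = w⁻¹ (hi i) ↔ (w b : ℕ) = i + 1 := by
      rw [Perm.eq_inv_iff_eq, Fin.ext_iff]; rfl
    have ha' : a = w⁻¹ (hi i) ↔ (w a : ℕ) = i + 1 := by
      rw [Perm.eq_inv_iff_eq, Fin.ext_iff]; rfl
    have hb' : b = w⁻¹ (lo i) ↔ (w b : ℕ) = i := by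
      rw [Perm.eq_inv_iff_eq, Fin.ext_iff]; rfl
    simp only [inversions, Finset.mem_filter, Finset.mem_univ, true_and, Finset.mem_insert,
      Prod.mk.injEq, Perm.mul_apply, Fin.lt_def, simple_val]
    rw [ha, hb]
    have hne : a < b → (w a : ℕ) ≠ w b := by
      intro hab h'
      exact hab.ne (w.injective (Fin.ext h'))
    rw [Fin.lt_def] at hne h
    by_cases h1 : (w a : ℕ) = i ∧ (w b : ℕ) = i + 1
    · have e1 := ha.2 h1.1
      have e2 := hb.2 h1.2
      have hab : (a : ℕ) < b := by rw [e1, e2]; exact h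
      rw [h1.1, h1.2]
      simp [hab]
    · by_cases h2 : (w a : ℕ) = i + 1 ∧ (w b : ℕ) = i
      · have e1 := ha'.2 h2.1
        have e2 := hb'.2 h2.2
        have hab : ¬ (a : ℕ) < b := by rw [e1, e2]; omega
        simp only [hab, false_and, or_false]
        exact ⟨False.elim, h1⟩
      · split_ifs <;> omega
  rw [this, Finset.card_insert_of_notMem]
  simp only [inversions, Finset.mem_filter, Finset.mem_univ, true_and, hlo, hhi, not_and]
  intro _
  exact not_lt.2 (lo_lt_hi i).le

theorem inv_simple_mul {n : ℕ} (i : Fin (n - 1)) (w : Perm (Fin n)) (x : Fin n) :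
    (simpleTransposition i * w)⁻¹ x = w⁻¹ (simpleTransposition i x) := by
  simp [simpleTransposition, mul_inv_rev]

theorem card_inversions_of_descent {n : ℕ} (i : Fin (n - 1)) (w : Perm (Fin n))
    (h : w⁻¹ (hi i) < w⁻¹ (lo i)) :
    (inversions (simpleTransposition i * w)).card + 1 = (inversions w).card := by
  have := card_inversions_of_ascent i (simpleTransposition i * w) (by
    rw [inv_simple_mul, inv_simple_mul]
    simpa [simpleTransposition] using h)
  rw [simpleTransposition_mul_cancel] at this
  exact this.symm

theorem ascent_or_descent {n : ℕ} (i : Fin (n - 1)) (w : Perm (Fin n)) :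
    w⁻¹ (lo i) < w⁻¹ (hi i) ∨ w⁻¹ (hi i) < w⁻¹ (lo i) :=
  lt_or_gt_of_ne fun h => (lo_lt_hi i).ne (w⁻¹.injective h)

theorem eq_one_of_forall_ascent {n : ℕ} (u : Perm (Fin n))
    (h : ∀ i : Fin (n - 1), u (lo i) < u (hi i)) : u = 1 := by
  cases n with
  | zero => exact Subsingleton.elim _ _
  | succ m =>
    have hm : StrictMono u := Fin.strictMono_iff_lt_succ.2 fun i => h i
    have : (hm.orderIsoOfSurjective u u.surjective) = OrderIso.refl _ := Subsingleton.elim _ _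
    ext x
    exact congrArg Fin.val (DFunLike.congr_fun this x)

theorem exists_descent {n : ℕ} {w : Perm (Fin n)} (h : w ≠ 1) :
    ∃ i : Fin (n - 1), w⁻¹ (hi i) < w⁻¹ (lo i) := by
  by_contra! hc
  apply h
  rw [← inv_eq_one]
  exact eq_one_of_forall_ascent _ fun i => (ascent_or_descent i w).resolve_right (hc i).not_gt

theorem exists_ascent {n : ℕ} {w : Perm (Fin n)} (h : w ≠ longest n) :
    ∃ i : Fin (n - 1), w⁻¹ (lo i) < w⁻¹ (hi i) := by
  by_contra! hc
  apply h
  have h1 : longest n * w⁻¹ = 1 := by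
    apply eq_one_of_forall_ascent
    intro i
    have := (ascent_or_descent i w).resolve_left (hc i).not_gt
    simpa [longest] using this
  exact (mul_inv_eq_one.1 h1).symm

theorem inversions_one {n : ℕ} : inversions (1 : Perm (Fin n)) = ∅ := by
  ext ⟨a, b⟩
  rw [inversions, Finset.mem_filter]
  constructor
  · rintro ⟨-, h1, h2⟩
    exact absurd h2 h1.not_gt
  · simp

theorem exists_word {n : ℕ} : ∀ (k : ℕ) (w : Perm (Fin n)), (inversions w).card = k →
    ∃ l : List (Fin (n - 1)), l.length = k ∧ w = (l.map simpleTransposition).prod := by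
  intro k
  induction k with
  | zero =>
    intro w hw
    refine ⟨[], rfl, ?_⟩
    by_contra hne
    obtain ⟨i, hi⟩ := exists_descent hne
    have := card_inversions_of_descent i w hi
    omega
  | succ k ih =>
    intro w hw
    have hne : w ≠ 1 := by
      rintro rfl
      simp [inversions_one] at hw
    obtain ⟨i, hi⟩ := exists_descent hne
    have := card_inversions_of_descent i w hi
    obtain ⟨l, hl, hl'⟩ := ih (simpleTransposition i * w) (by omega)
    refine ⟨i :: l, by simp [hl], ?_⟩
    rw [List.map_cons, List.prod_cons, ← hl', simpleTransposition_mul_cancel]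

theorem card_inversions_word_le {n : ℕ} (l : List (Fin (n - 1))) :
    (inversions (l.map simpleTransposition).prod).card ≤ l.length := by
  induction l with
  | nil => simp [inversions_one]
  | cons i l ih =>
    rw [List.map_cons, List.prod_cons, List.length_cons]
    rcases ascent_or_descent i (l.map simpleTransposition).prod with h | h
    · have := card_inversions_of_ascent i _ h
      omega
    · have := card_inversions_of_descent i _ h
      omega

/-- The length of `w` is its number of inversions. -/
theorem length_eq_card_inversions {n : ℕ} (w : Perm (Fin n)) :
    length w = (inversions w).card := by
  apply le_antisymm
  · exact Nat.sInf_le (exists_word _ w rfl)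
  · obtain ⟨l, hl, hw⟩ := Nat.sInf_mem (⟨_, exists_word _ w rfl⟩ : Set.Nonempty
      {k | ∃ l : List (Fin (n - 1)), l.length = k ∧ w = (l.map simpleTransposition).prod})
    have := card_inversions_word_le l
    rw [← hw, hl] at this
    exact this

theorem length_ascent {n : ℕ} {i : Fin (n - 1)} {w : Perm (Fin n)}
    (h : w⁻¹ (lo i) < w⁻¹ (hi i)) : length (simpleTransposition i * w) = length w + 1 := by
  simpa only [length_eq_card_inversions] using card_inversions_of_ascent i w h

theorem length_descent_iff {n : ℕ} {i : Fin (n - 1)} {w : Perm (Fin n)} :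
    length (simpleTransposition i * w) < length w ↔ w⁻¹ (hi i) < w⁻¹ (lo i) := by
  simp only [length_eq_card_inversions]
  rcases ascent_or_descent i w with h | h
  · have := card_inversions_of_ascent i w h
    simp only [h.not_gt, iff_false]
    omega
  · have := card_inversions_of_descent i w h
    simp only [h, iff_true]
    omega

theorem length_le {n : ℕ} (w : Perm (Fin n)) : length w ≤ n * n := by
  rw [length_eq_card_inversions]
  refine (Finset.card_le_univ _).trans ?_
  simp

theorem IsSchubert.of_ascent {n : ℕ} {i : Fin (n - 1)} {w : Perm (Fin n)}
    {g : MvPolynomial (Fin n) ℂ} (h : w⁻¹ (lo i) < w⁻¹ (hi i))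
    (hg : IsSchubert (simpleTransposition i * w) g) : IsSchubert w (newton i g) := by
  have := hg.step i (by
    rw [simpleTransposition_mul_cancel, length_ascent h]; omega)
  rwa [simpleTransposition_mul_cancel] at this

theorem IsSchubert.eq_or {n : ℕ} {w : Perm (Fin n)} {g : MvPolynomial (Fin n) ℂ}
    (hg : IsSchubert w g) :
    (w = longest n ∧ g = ∏ i : Fin (n - 1), X (lo i) ^ staircase n i) ∨
      ∃ (i : Fin (n - 1)) (g' : MvPolynomial (Fin n) ℂ), w⁻¹ (lo i) < w⁻¹ (hi i) ∧
        IsSchubert (simpleTransposition i * w) g' ∧ g = newton i g' := by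
  cases hg with
  | top => exact Or.inl ⟨rfl, rfl⟩
  | @step w g i h hl =>
    refine Or.inr ⟨i, g, ?_, ?_, rfl⟩
    · rw [length_descent_iff] at hl
      rw [inv_simple_mul, inv_simple_mul]
      simpa [simpleTransposition] using hl
    · rwa [simpleTransposition_mul_cancel]

theorem exists_isSchubert {n : ℕ} (w : Perm (Fin n)) : ∃ g, IsSchubert w g := by
  induction hk : n * n - length w generalizing w with
  | zero =>
    by_cases h : w = longest n
    · subst h; exact ⟨_, .top⟩
    · obtain ⟨i, hi⟩ := exists_ascent h
      have h1 := length_ascent hi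
      have h2 := length_le (simpleTransposition i * w)
      omega
  | succ k ih =>
    by_cases h : w = longest n
    · subst h; exact ⟨_, .top⟩
    · obtain ⟨i, hi⟩ := exists_ascent h
      have h1 := length_ascent hi
      obtain ⟨g, hg⟩ := ih (simpleTransposition i * w) (by omega)
      exact ⟨_, hg.of_ascent hi⟩

theorem longest_not_ascent {n : ℕ} (i : Fin (n - 1)) :
    ¬ (longest n)⁻¹ (lo i) < (longest n)⁻¹ (hi i) := by
  have : (longest n)⁻¹ = longest n := by
    rw [inv_eq_iff_mul_eq_one]; ext x; simp [longest]
  rw [this]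
  simpa [longest] using (lo_lt_hi i).le

theorem isSchubert_unique_aux {n : ℕ} (k : ℕ) : ∀ (w : Perm (Fin n)), n * n - length w ≤ k →
    ∀ g g', IsSchubert w g → IsSchubert w g' → g = g' := by
  induction k with
  | zero =>
    intro w hk g g' hg hg'
    have hw : w = longest n := by
      by_contra h
      obtain ⟨i, hi⟩ := exists_ascent h
      have h1 := length_ascent hi
      have h2 := length_le (simpleTransposition i * w)
      omega
    subst hw
    rcases hg.eq_or with ⟨-, rfl⟩ | ⟨i, _, hi, -⟩
    · rcases hg'.eq_or with ⟨-, rfl⟩ | ⟨i, _, hi, -⟩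
      · rfl
      · exact absurd hi (longest_not_ascent i)
    · exact absurd hi (longest_not_ascent i)
  | succ k ih =>
    intro w hk g g' hg hg'
    have up : ∀ i : Fin (n - 1), w⁻¹ (lo i) < w⁻¹ (hi i) → ∀ g g',
        IsSchubert (simpleTransposition i * w) g → IsSchubert (simpleTransposition i * w) g' →
          g = g' := by
      intro i hi
      have := length_ascent hi
      exact ih _ (by omega)
    -- it suffices to compare two distinct ascents, the first one being smaller
    have main : ∀ (i j : Fin (n - 1)) (f f' : MvPolynomial (Fin n) ℂ), i < j →
        w⁻¹ (lo i) < w⁻¹ (hi i) → w⁻¹ (lo j) < w⁻¹ (hi j) →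
        IsSchubert (simpleTransposition i * w) f → IsSchubert (simpleTransposition j * w) f' →
        newton i f = newton j f' := by
      intro i j f f' hij hi' hj' hf hf'
      have hijv : (i : ℕ) < j := hij
      by_cases hadj : (j : ℕ) = i + 1
      · have hm : hi i = lo j := Fin.ext (by simp [hi, lo, hadj])
        have n1 : lo i ≠ lo j := by simp [lo, Fin.ext_iff]; omega
        have n2 : lo i ≠ hi j := by simp [lo, hi, Fin.ext_iff]; omega
        have n3 : lo j ≠ hi j := (lo_lt_hi j).ne
        have hlt : w⁻¹ (lo i) < w⁻¹ (lo j) := hm ▸ hi'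
        have si : simpleTransposition i = swap (lo i) (lo j) := by
          rw [simpleTransposition, hm]
        have sj : simpleTransposition j = swap (lo j) (hi j) := rfl
        have a1 : (simpleTransposition i * w)⁻¹ (lo j) < (simpleTransposition i * w)⁻¹ (hi j) := by
          rw [inv_simple_mul, inv_simple_mul, si, swap_apply_right,
            swap_apply_of_ne_of_ne n2.symm n3.symm]
          exact hlt.trans hj'
        have a2 : (simpleTransposition j * (simpleTransposition i * w))⁻¹ (lo i) <
            (simpleTransposition j * (simpleTransposition i * w))⁻¹ (hi i) := by
          rw [hm]
          simp only [inv_simple_mul]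
          rw [sj, swap_apply_left, swap_apply_of_ne_of_ne n1 n2, si, swap_apply_left,
            swap_apply_of_ne_of_ne n2.symm n3.symm]
          exact hj'
        have b1 : (simpleTransposition j * w)⁻¹ (lo i) < (simpleTransposition j * w)⁻¹ (hi i) := by
          rw [hm, inv_simple_mul, inv_simple_mul, sj, swap_apply_left,
            swap_apply_of_ne_of_ne n1 n2]
          exact hlt.trans hj'
        have b2 : (simpleTransposition i * (simpleTransposition j * w))⁻¹ (lo j) <
            (simpleTransposition i * (simpleTransposition j * w))⁻¹ (hi j) := by
          simp only [inv_simple_mul]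
          rw [si, swap_apply_right, swap_apply_of_ne_of_ne n2.symm n3.symm, sj,
            swap_apply_right, swap_apply_of_ne_of_ne n1 n2]
          exact hlt
        have hbr : simpleTransposition i * (simpleTransposition j * (simpleTransposition i * w)) =
            simpleTransposition j * (simpleTransposition i * (simpleTransposition j * w)) := by
          have hb := swap_braid n1 n3 n2
          rw [← si, ← sj] at hb
          calc _ = simpleTransposition i * simpleTransposition j * simpleTransposition i * w := by
                simp only [mul_assoc]
            _ = _ := by rw [hb]; simp only [mul_assoc]
        obtain ⟨e, he⟩ := exists_isSchubert
          (simpleTransposition i * (simpleTransposition j * (simpleTransposition i * w)))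
        have e1 := up i hi' _ _ hf ((he.of_ascent a2).of_ascent a1)
        rw [hbr] at he
        have e2 := up j hj' _ _ hf' ((he.of_ascent b2).of_ascent b1)
        rw [e1, e2]
        simp only [newton, hm]
        exact divDiff_braid n1 n3 n2 e
      · have n1 : lo i ≠ lo j := by simp [lo, Fin.ext_iff]; omega
        have n2 : lo i ≠ hi j := by simp [lo, hi, Fin.ext_iff]; omega
        have n3 : hi i ≠ lo j := by simp [lo, hi, Fin.ext_iff]; omega
        have n4 : hi i ≠ hi j := by simp [hi, Fin.ext_iff]; omega
        have a1 : (simpleTransposition i * w)⁻¹ (lo j) < (simpleTransposition i * w)⁻¹ (hi j) := by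
          rw [inv_simple_mul, inv_simple_mul, simpleTransposition,
            swap_apply_of_ne_of_ne n1.symm n3.symm, swap_apply_of_ne_of_ne n2.symm n4.symm]
          exact hj'
        have b1 : (simpleTransposition j * w)⁻¹ (lo i) < (simpleTransposition j * w)⁻¹ (hi i) := by
          rw [inv_simple_mul, inv_simple_mul, simpleTransposition,
            swap_apply_of_ne_of_ne n1 n2, swap_apply_of_ne_of_ne n3 n4]
          exact hi'
        have hcm : simpleTransposition j * (simpleTransposition i * w) =
            simpleTransposition i * (simpleTransposition j * w) := by
          rw [← mul_assoc, ← mul_assoc]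
          congr 1
          exact (swap_commute n1 n2 n3 n4).eq.symm
        obtain ⟨e, he⟩ := exists_isSchubert (simpleTransposition j * (simpleTransposition i * w))
        have e1 := up i hi' _ _ hf (he.of_ascent a1)
        rw [hcm] at he
        have e2 := up j hj' _ _ hf' (he.of_ascent b1)
        rw [e1, e2]
        exact divDiff_commute (lo_lt_hi i).ne (lo_lt_hi j).ne n1 n2 n3 n4 e
    rcases hg.eq_or with ⟨rfl, rfl⟩ | ⟨i, f, hi', hf, rfl⟩
    · rcases hg'.eq_or with ⟨-, rfl⟩ | ⟨i, _, hi', -⟩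
      · rfl
      · exact absurd hi' (longest_not_ascent i)
    · rcases hg'.eq_or with ⟨rfl, -⟩ | ⟨j, f', hj', hf', rfl⟩
      · exact absurd hi' (longest_not_ascent i)
      · rcases lt_trichotomy i j with hij | rfl | hij
        · exact main i j f f' hij hi' hj' hf hf'
        · rw [up i hi' f f' hf hf']
        · exact (main j i f' f hij hj' hi' hf' hf).symm

end WellDefined

/-- The rules determine exactly one polynomial for every permutation. -/
theorem existsUnique_isSchubert {n : ℕ} (w : Perm (Fin n)) : ∃! g, IsSchubert w g := by
  obtain ⟨g, hg⟩ := exists_isSchubert w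
  exact ⟨g, hg, fun g' hg' => isSchubert_unique_aux _ w le_rfl _ _ hg' hg⟩

/-- The Schubert polynomial `𝔖_w`. It lives in `ℂ[x_1, …, x_n]`, on which all the `N_i` act, but
does not involve `x_n`, see `degreeOf_schubert_le`. -/
noncomputable def schubert {n : ℕ} (w : Perm (Fin n)) : MvPolynomial (Fin n) ℂ :=
  (existsUnique_isSchubert w).choose

theorem isSchubert_schubert {n : ℕ} (w : Perm (Fin n)) : IsSchubert w (schubert w) :=
  (existsUnique_isSchubert w).choose_spec.1

theorem schubert_longest (n : ℕ) :
    schubert (longest n) = ∏ i : Fin (n - 1), X (lo i) ^ staircase n i :=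
  (existsUnique_isSchubert _).unique (isSchubert_schubert _) .top

theorem schubert_simpleTransposition_mul {n : ℕ} (i : Fin (n - 1)) (w : Perm (Fin n))
    (h : length (simpleTransposition i * w) < length w) :
    schubert (simpleTransposition i * w) = newton i (schubert w) :=
  (existsUnique_isSchubert _).unique (isSchubert_schubert _) ((isSchubert_schubert w).step i h)

/-- The Schubert polynomials lie in the span of the `x^α` with `α ≤ ρ` (and `α_n = 0`). -/
theorem degreeOf_schubert_le {n : ℕ} (w : Perm (Fin n)) (k : Fin n) :
    degreeOf k (schubert w) ≤ n - 1 - k := by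
  have hS := isSchubert_schubert w
  generalize schubert w = f at hS
  induction hS generalizing k with
  | top =>
    refine (degreeOf_prod_le _ _ _).trans ?_
    by_cases hk : (k : ℕ) < n - 1
    · rw [Finset.sum_eq_single ⟨k, hk⟩]
      · refine (degreeOf_pow_le _ _ _).trans ?_
        have : lo ⟨(k : ℕ), hk⟩ = k := rfl
        simp [this, staircase]
      · intro i _ hi
        refine degreeOf_X_pow_of_ne _ ?_
        rintro rfl
        exact hi rfl
      · simp
    · rw [Finset.sum_eq_zero]
      · omega
      · intro i _
        refine degreeOf_X_pow_of_ne _ ?_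
        rintro rfl
        exact hk i.2
  | @step w g i _ _ ih =>
    by_cases hz : newton i g = 0
    · simp [hz]
    have hne := X_sub_X_ne_zero (lo_lt_hi i).ne
    have hspec := divDiff_spec (lo i) (hi i) g
    have hmul := degreeOf_mul_eq (n := k) hne hz
    have hdeg : ∀ m : Fin n, degreeOf (swap (lo i) (hi i) m)
        (rename (swap (lo i) (hi i)) g) = degreeOf m g := fun m =>
      degreeOf_rename_of_injective (swap (lo i) (hi i)).injective m
    have hsub := degreeOf_sub_le k g (rename (swap (lo i) (hi i)) g)
    rw [newton] at *
    rw [hspec] at hmul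
    have hx1 : k = lo i ∨ k = hi i →
        1 ≤ degreeOf k (X (lo i) - X (hi i) : MvPolynomial (Fin n) ℂ) := by
      intro hk
      by_contra hlt
      have h0 : degreeOf k (X (lo i) - X (hi i) : MvPolynomial (Fin n) ℂ) = 0 := by omega
      rcases hk with rfl | rfl
      · have h1 := degreeOf_add_le (lo i) (X (lo i) - X (hi i) : MvPolynomial (Fin n) ℂ) (X (hi i))
        rw [sub_add_cancel, degreeOf_X_self, h0, degreeOf_X_of_ne (lo_lt_hi i).ne] at h1
        simp at h1
      · have h1 := degreeOf_sub_le (hi i) (X (lo i) : MvPolynomial (Fin n) ℂ)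
          (X (lo i) - X (hi i))
        rw [sub_sub_cancel, degreeOf_X_self, h0, degreeOf_X_of_ne (lo_lt_hi i).ne'] at h1
        simp at h1
    have hlo : ((lo i : Fin n) : ℕ) = i := rfl
    have hhi : ((hi i : Fin n) : ℕ) = i + 1 := rfl
    by_cases h1 : k = lo i
    · subst h1
      have d1 := hdeg (hi i)
      rw [swap_apply_right] at d1
      have := ih (lo i)
      have := ih (hi i)
      have := hx1 (Or.inl rfl)
      omega
    · by_cases h2 : k = hi i
      · subst h2
        have d1 := hdeg (lo i)
        rw [swap_apply_left] at d1
        have := ih (lo i)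
        have := ih (hi i)
        have := hx1 (Or.inr rfl)
        omega
      · have d1 := hdeg k
        rw [swap_apply_of_ne_of_ne h1 h2] at d1
        have := ih k
        omega

/-! ### Padded Schubert polynomials -/

/-- The ring `ℂ[x_1, …, x_{n-1}; y_1, …, y_{n-1}]`. -/
abbrev XYPoly (n : ℕ) : Type := MvPolynomial (Fin (n - 1) ⊕ Fin (n - 1)) ℂ

/-- The monomial `x^α y^{ρ-α}`; it is used for `α ≤ ρ`. -/
noncomputable def paddedMonomial (n : ℕ) (α : Fin (n - 1) → ℕ) : XYPoly n :=
  ∏ i : Fin (n - 1), (X (Sum.inl i) ^ α i * X (Sum.inr i) ^ (staircase n i - α i))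

/-- The space `Ṽ` spanned by the `x^α y^{ρ-α}` with `α ≤ ρ`. -/
noncomputable def paddedSpace (n : ℕ) : Submodule ℂ (XYPoly n) :=
  Submodule.span ℂ {f | ∃ α : Fin (n - 1) → ℕ, α ≤ staircase n ∧ f = paddedMonomial n α}

/-- The linear map with `x^α ↦ x^α y^{ρ-α}`. It is only applied to polynomials in the span of the
`x^α` with `α ≤ ρ`. -/
noncomputable def padding (n : ℕ) : MvPolynomial (Fin n) ℂ →ₗ[ℂ] XYPoly n :=
  (basisMonomials (Fin n) ℂ).constr ℂ fun α => paddedMonomial n fun i => α (lo i)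

/-- The padded Schubert polynomial of `w`. -/
noncomputable def paddedSchubert {n : ℕ} (w : Perm (Fin n)) : XYPoly n :=
  padding n (schubert w)

/-- The operator `Δ = ∑ x_i ∂/∂y_i`. -/
noncomputable def Delta (n : ℕ) : XYPoly n →ₗ[ℂ] XYPoly n :=
  ∑ i : Fin (n - 1),
    LinearMap.mulLeft ℂ (X (Sum.inl i)) ∘ₗ (pderiv (Sum.inr i)).toLinearMap

end PaddedSchubert

namespace PaddedSchubert

open MvPolynomial Equiv

/-! The formula for `Δ` comes from a uniqueness property of `sl₂`-actions. On the span of the `x^α`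
with `α ≤ ρ`, padding turns `E = ∑ ρ_i x_i - ∑ x_i² ∂/∂x_i` (`raising`) into `Δ` (`Delta_padding`).
With `∇ = ∑ ∂/∂x_i` and Euler's operator `H` one has `[∇, E] = |ρ| - 2H`.

The lowering operator is easy to compute on Schubert polynomials: `∇` commutes with divided
differences, so descending from `x^ρ` gives `∇ 𝔖_w = ∑ k 𝔖_{w s_k}` over the right descents `k`
(counted from `1`) of `w` (`nabla_schubert`). Let `D` be this weighted down operator on
permutations, `U` the strong Bruhat operator weighted by code distance and `L` multiplication by
length. Then `[D, U] = |ρ| - 2L` (`weakDown_strongUp`): off the diagonal the terms cancel in pairs,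
by the exchange property and because stripping a common right descent preserves code distance; the
diagonal is evaluated by Abel summation.

The map `Φ : w ↦ 𝔖_w` therefore intertwines `D` with `∇` and `L` with `H`. The defect `EΦ - ΦU` is a
lowest weight vector of positive weight for `sl₂` acting on linear maps. Since degrees in the
staircase span are bounded, repeated raising kills it, so it is zero (`raising_intertwines`).

For the basis statement, divided differences reduce a linear relation among the `𝔖_w` to shorter
permutations, padding is injective on the staircase span, and `Ṽ` is spanned by `n!` monomials. -/

/-! ### Length, transpositions and covers in the strong Bruhat order -/

theorem length_inv {n : ℕ} (w : Perm (Fin n)) : length w⁻¹ = length w := by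
  have key : ∀ u : Perm (Fin n), length u⁻¹ ≤ length u := by
    intro u
    obtain ⟨l, hl, hu⟩ := Nat.sInf_mem (⟨_, exists_word _ u rfl⟩ : Set.Nonempty
      {k | ∃ l : List (Fin (n - 1)), l.length = k ∧ u = (l.map simpleTransposition).prod})
    refine Nat.sInf_le ⟨l.reverse, ?_, ?_⟩
    · rw [List.length_reverse, hl]; rfl
    · rw [hu, List.prod_inv_reverse, List.map_map, List.map_reverse]
      congr 3
  exact le_antisymm (key w) (by simpa using key w⁻¹)

theorem simpleTransposition_inv {n : ℕ} (k : Fin (n - 1)) :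
    (simpleTransposition k)⁻¹ = simpleTransposition k := by
  simp [simpleTransposition]

theorem mul_simpleTransposition_cancel {n : ℕ} (w : Perm (Fin n)) (k : Fin (n - 1)) :
    w * simpleTransposition k * simpleTransposition k = w := by
  rw [mul_assoc, simpleTransposition_mul_self, mul_one]

theorem simpleTransposition_lo {n : ℕ} (k : Fin (n - 1)) :
    simpleTransposition k (lo k) = hi k := swap_apply_left _ _

theorem simpleTransposition_hi {n : ℕ} (k : Fin (n - 1)) :
    simpleTransposition k (hi k) = lo k := swap_apply_right _ _

theorem length_mul_simple_of_lt {n : ℕ} {w : Perm (Fin n)} {k : Fin (n - 1)}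
    (h : w (lo k) < w (hi k)) : length (w * simpleTransposition k) = length w + 1 := by
  rw [← length_inv, mul_inv_rev, simpleTransposition_inv, length_ascent (by simpa using h),
    length_inv]

theorem length_mul_simple_of_gt {n : ℕ} {w : Perm (Fin n)} {k : Fin (n - 1)}
    (h : w (hi k) < w (lo k)) : length (w * simpleTransposition k) + 1 = length w := by
  have := length_mul_simple_of_lt (w := w * simpleTransposition k) (k := k) (by
    simpa [simpleTransposition_lo, simpleTransposition_hi] using h)
  rw [mul_simpleTransposition_cancel] at this
  exact this.symm

theorem apply_lo_lt_or_gt {n : ℕ} (w : Perm (Fin n)) (k : Fin (n - 1)) :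
    w (lo k) < w (hi k) ∨ w (hi k) < w (lo k) :=
  lt_or_gt_of_ne fun h => (lo_lt_hi k).ne (w.injective h)

theorem length_mul_simple_lt_iff {n : ℕ} {w : Perm (Fin n)} {k : Fin (n - 1)} :
    length (w * simpleTransposition k) < length w ↔ w (hi k) < w (lo k) := by
  rcases apply_lo_lt_or_gt w k with h | h
  · have := length_mul_simple_of_lt h
    simp only [h.not_gt, iff_false]
    omega
  · have := length_mul_simple_of_gt h
    simp only [h, iff_true]
    omega

theorem exists_lo_hi {n : ℕ} {a b : Fin n} (h : (b : ℕ) = a + 1) :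
    ∃ k : Fin (n - 1), lo k = a ∧ hi k = b :=
  ⟨⟨a, by omega⟩, rfl, Fin.ext h.symm⟩

/-- Induction on the distance between the positions, through `(a b) = s (a b-1) s` with `s = (b-1
b)`. The middle factor lengthens by induction, the outer ones change the length by `±1`, and if the
first one shortens then the last one lengthens. -/
theorem length_lt_mul_swap {n : ℕ} (d : ℕ) : ∀ (w : Perm (Fin n)) (a b : Fin n),
    (b : ℕ) = a + d + 1 → w a < w b → length w < length (w * swap a b) := by
  induction d with
  | zero =>
    intro w a b hab h
    obtain ⟨k, rfl, rfl⟩ := exists_lo_hi (a := a) (b := b) (by omega)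
    have := length_mul_simple_of_lt h
    rw [simpleTransposition] at this
    omega
  | succ d ih =>
    intro w a b hab h
    obtain ⟨k, hk, rfl⟩ := exists_lo_hi (a := (⟨a + d + 1, by omega⟩ : Fin n)) (b := b)
      (by simp; omega)
    have hak : (lo k : ℕ) = a + d + 1 := by rw [hk]
    have n1 : a ≠ lo k := by intro h; rw [← h] at hak; omega
    have n2 : a ≠ hi k := by rintro rfl; omega
    have n3 := (lo_lt_hi k).ne
    have e1 : simpleTransposition k a = a := swap_apply_of_ne_of_ne n1 n2
    have hs : swap a (hi k) = simpleTransposition k * swap a (lo k) * simpleTransposition k := by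
      rw [simpleTransposition, swap_mul_swap_mul_swap n1 n2, swap_comm]
    have h1 := ih (w * simpleTransposition k) a (lo k) hak (by
      simpa [e1, simpleTransposition_lo] using h)
    set u := w * simpleTransposition k * swap a (lo k) with hu
    have u1 : u (lo k) = w a := by simp [hu, e1]
    have u2 : u (hi k) = w (lo k) := by
      simp [hu, swap_apply_of_ne_of_ne n2.symm n3.symm, simpleTransposition_hi]
    rw [hs, ← mul_assoc, ← mul_assoc, ← hu]
    rcases apply_lo_lt_or_gt w k with c1 | c1
    · have l1 := length_mul_simple_of_lt c1
      rcases apply_lo_lt_or_gt u k with c2 | c2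
      · have l2 := length_mul_simple_of_lt c2
        omega
      · have l2 := length_mul_simple_of_gt c2
        omega
    · have l1 := length_mul_simple_of_gt c1
      have l2 := length_mul_simple_of_lt (w := u) (k := k) (by rw [u1, u2]; exact h.trans c1)
      omega

theorem length_lt_length_mul_swap {n : ℕ} {w : Perm (Fin n)} {a b : Fin n} (hab : a < b)
    (h : w a < w b) : length w < length (w * swap a b) :=
  length_lt_mul_swap (b - a - 1) w a b (by have : (a : ℕ) < b := hab; omega) h

theorem lt_of_length_lt_mul_swap {n : ℕ} {w : Perm (Fin n)} {a b : Fin n} (hab : a < b)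
    (h : length w < length (w * swap a b)) : w a < w b := by
  by_contra hc
  have hlt : w b < w a := lt_of_le_of_ne (not_lt.1 hc) fun e => hab.ne (w.injective e).symm
  have := length_lt_length_mul_swap (w := w * swap a b) hab (by simpa using hlt)
  rw [mul_assoc, swap_mul_self, mul_one] at this
  omega

/-- With a value in between, `(a b) = (a m)(m b)(a m)` would be three successive lengthening steps,
so the length would grow by at least `3`. -/
theorem not_between_of_length_mul_swap {n : ℕ} {w : Perm (Fin n)} {a b m : Fin n} (ham : a < m)
    (hmb : m < b) (h : length (w * swap a b) = length w + 1) : ¬ (w a < w m ∧ w m < w b) := by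
  rintro ⟨h1, h2⟩
  have hs : swap a b = swap a m * swap m b * swap a m := by
    rw [swap_comm a m, swap_comm m b, swap_mul_swap_mul_swap hmb.ne' (ham.trans hmb).ne']
  have hab := ham.trans hmb
  have l1 := length_lt_length_mul_swap ham h1
  have l2 := length_lt_length_mul_swap (w := w * swap a m) hmb (by
    simpa [swap_apply_of_ne_of_ne hab.ne' hmb.ne'] using h1.trans h2)
  have l3 := length_lt_length_mul_swap (w := w * swap a m * swap m b) ham (by
    simpa [swap_apply_of_ne_of_ne ham.ne hab.ne, swap_apply_of_ne_of_ne hab.ne' hmb.ne'] using h2)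
  rw [hs, ← mul_assoc, ← mul_assoc] at h
  omega

/-- The exchange property of the strong Bruhat order. -/
theorem StrongCover.descent {n : ℕ} {w v : Perm (Fin n)} {k : Fin (n - 1)} (h : StrongCover w v)
    (hv : v (hi k) < v (lo k)) (hne : v ≠ w * simpleTransposition k) : w (hi k) < w (lo k) := by
  obtain ⟨⟨a, b, hab, rfl⟩, hl⟩ := h
  have hw := lt_of_length_lt_mul_swap (w := w) hab (by omega)
  by_contra hc
  have hk := (apply_lo_lt_or_gt w k).resolve_right hc
  have hlh := lo_lt_hi k
  have hval : (hi k : ℕ) = lo k + 1 := rfl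
  rw [Perm.mul_apply, Perm.mul_apply] at hv
  -- The cases record how `{a, b}` meets the adjacent positions of `s_k`. If `a = lo k` or `b = hi
  -- k`, the other position of `s_k` lies strictly between `a` and `b` and carries an intermediate
  -- value, which a cover forbids. The remaining cases contradict `hw`, `hk` or `hc`.
  by_cases a1 : a = lo k
  · subst a1
    have b1 : b ≠ hi k := by rintro rfl; exact hne rfl
    rw [swap_apply_left, swap_apply_of_ne_of_ne hlh.ne' b1.symm] at hv
    exact not_between_of_length_mul_swap hlh (lt_of_le_of_ne (Fin.le_def.2 (by
      rw [Fin.lt_def] at hab; omega)) b1.symm) hl ⟨hk, hv⟩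
  by_cases a2 : a = hi k
  · subst a2
    rw [swap_apply_left, swap_apply_of_ne_of_ne hlh.ne (hlh.trans hab).ne] at hv
    exact absurd (hv.trans hk) hw.not_gt
  by_cases b1 : b = lo k
  · subst b1
    rw [swap_apply_right, swap_apply_of_ne_of_ne (Ne.symm a2) hlh.ne'] at hv
    exact absurd (hv.trans hw) hk.not_gt
  by_cases b2 : b = hi k
  · subst b2
    rw [swap_apply_right, swap_apply_of_ne_of_ne (Ne.symm a1) hlh.ne] at hv
    exact not_between_of_length_mul_swap (m := lo k) (lt_of_le_of_ne (Fin.le_def.2 (by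
      rw [Fin.lt_def] at hab; omega)) a1) hlh hl ⟨hv, hk⟩
  rw [swap_apply_of_ne_of_ne (Ne.symm a1) (Ne.symm b1),
    swap_apply_of_ne_of_ne (Ne.symm a2) (Ne.symm b2)] at hv
  exact hc hv

/-- A conjugate of a transposition is a transposition; its two letters may have to be exchanged to
restore `i < j`. -/
theorem exists_swap_mul_simple {n : ℕ} {w v : Perm (Fin n)} (k : Fin (n - 1))
    (h : ∃ i j : Fin n, i < j ∧ v = w * swap i j) :
    ∃ i j : Fin n, i < j ∧ v * simpleTransposition k = w * simpleTransposition k * swap i j := by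
  obtain ⟨a, b, hab, rfl⟩ := h
  set s := simpleTransposition k with hs
  have hconj : w * swap a b * s = w * s * swap (s a) (s b) := by
    have := mul_swap_eq_swap_mul s (s a) (s b)
    have h2 : ∀ x, s (s x) = x := fun x => by
      rw [← Perm.mul_apply, hs, simpleTransposition_mul_self, Perm.one_apply]
    rw [h2, h2] at this
    rw [mul_assoc, ← this, mul_assoc]
  rcases lt_or_gt_of_ne (s.injective.ne hab.ne) with h | h
  · exact ⟨_, _, h, hconj⟩
  · exact ⟨_, _, h, by rw [hconj, swap_comm]⟩

theorem strongCover_mul_simple {n : ℕ} {w v : Perm (Fin n)} {k : Fin (n - 1)}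
    (h : StrongCover w v) (hw : w (hi k) < w (lo k)) (hv : v (hi k) < v (lo k)) :
    StrongCover (w * simpleTransposition k) (v * simpleTransposition k) := by
  refine ⟨exists_swap_mul_simple k h.1, ?_⟩
  have := length_mul_simple_of_gt hw
  have := length_mul_simple_of_gt hv
  have := h.2
  omega

/-- This pairs the paths `w → v → v s_k` (up, down) with the paths `w → w s_k → v s_k` (down, up).
The converse direction uses the exchange property for the cover of `w s_k` by `v s_k`. -/
theorem strongCover_mul_simple_iff {n : ℕ} {w v : Perm (Fin n)} {k : Fin (n - 1)}
    (hne : v ≠ w * simpleTransposition k) :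
    (StrongCover w v ∧ v (hi k) < v (lo k)) ↔ (w (hi k) < w (lo k) ∧
      StrongCover (w * simpleTransposition k) (v * simpleTransposition k)) := by
  constructor
  · rintro ⟨h, hv⟩
    have hw := h.descent hv hne
    exact ⟨hw, strongCover_mul_simple h hw hv⟩
  · rintro ⟨hw, h⟩
    have hv : v (hi k) < v (lo k) := by
      by_contra hc
      have h1 := h.descent (k := k) (by
        simpa [simpleTransposition_lo, simpleTransposition_hi] using
          (apply_lo_lt_or_gt v k).resolve_right hc) (by
        rw [mul_simpleTransposition_cancel]
        rintro rfl
        exact hne (mul_simpleTransposition_cancel _ _).symm)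
      simp only [Perm.mul_apply, simpleTransposition_lo, simpleTransposition_hi] at h1
      exact h1.not_gt hw
    refine ⟨⟨?_, ?_⟩, hv⟩
    · have := exists_swap_mul_simple k h.1
      simpa only [mul_simpleTransposition_cancel] using this
    · have := length_mul_simple_of_gt hw
      have := length_mul_simple_of_gt hv
      have := h.2
      omega

/-! ### The code -/

/-- The code of `w` with its last entry, which is `0`. -/
def fullCode {n : ℕ} (w : Perm (Fin n)) (i : Fin n) : ℕ :=
  (Finset.univ.filter fun j : Fin n => i < j ∧ w j < w i).card

theorem sum_fullCode {n : ℕ} (w : Perm (Fin n)) : ∑ i, fullCode w i = length w := by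
  rw [length_eq_card_inversions, inversions]
  simp only [fullCode, Finset.card_filter, Fintype.sum_prod_type]

theorem fullCode_longest {n : ℕ} (i : Fin n) : fullCode (longest n) i = n - 1 - i := by
  have : (Finset.univ.filter fun j : Fin n => i < j ∧ longest n j < longest n i)
      = Finset.Ioi i := by
    ext j; simp [longest]
  rw [fullCode, this, Fin.card_Ioi]

theorem fullCode_eq_zero {n : ℕ} (w : Perm (Fin n)) (i : Fin n) (h : (i : ℕ) + 1 = n) :
    fullCode w i = 0 := by
  rw [fullCode, Finset.card_eq_zero, Finset.filter_eq_empty_iff]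
  rintro j - ⟨h1, -⟩
  rw [Fin.lt_def] at h1
  omega

theorem sum_lo {M : Type*} [AddCommMonoid M] {n : ℕ} (f : Fin n → M)
    (h : ∀ i : Fin n, (i : ℕ) + 1 = n → f i = 0) : ∑ i : Fin (n - 1), f (lo i) = ∑ i, f i := by
  cases n with
  | zero => simp
  | succ m =>
    rw [Fin.sum_univ_castSucc, h (Fin.last m) rfl, add_zero]
    rfl

theorem codeDistance_eq_sum {n : ℕ} (w v : Perm (Fin n)) :
    codeDistance w v = ∑ i : Fin n, |(fullCode w i : ℤ) - fullCode v i| := by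
  rw [← sum_lo]
  · rfl
  · intro i h
    simp [fullCode_eq_zero _ i h]

/-- Reindexing `j` by `s_k` moves the transposition from the values to the positions, so that the
codes of `w s_k` and `w` count the same values. -/
theorem fullCode_mul_simple_eq {n : ℕ} (w : Perm (Fin n)) (k : Fin (n - 1)) (i : Fin n) :
    fullCode (w * simpleTransposition k) i = (Finset.univ.filter fun j : Fin n =>
      i < simpleTransposition k j ∧ w j < w (simpleTransposition k i)).card := by
  rw [fullCode, Finset.card_filter, Finset.card_filter,
    ← Equiv.sum_comp (simpleTransposition k)]
  have h2 : ∀ x, simpleTransposition k (simpleTransposition k x) = x := fun x => by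
      rw [← Perm.mul_apply, simpleTransposition_mul_self, Perm.one_apply]
  simp only [Perm.mul_apply, h2]

theorem fullCode_mul_simple_lo {n : ℕ} {w : Perm (Fin n)} {k : Fin (n - 1)}
    (h : w (hi k) < w (lo k)) :
    fullCode (w * simpleTransposition k) (lo k) = fullCode w (hi k) := by
  rw [fullCode_mul_simple_eq, simpleTransposition_lo, fullCode]
  congr 1
  refine Finset.filter_congr fun j _ => and_congr_left fun hj => ?_
  have hj' : j ≠ lo k := by rintro rfl; exact hj.not_gt h
  have : (j : ℕ) ≠ k := fun e => hj' (Fin.ext e)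
  rw [Fin.lt_def, Fin.lt_def, simple_val]
  simp only [lo, hi]
  split_ifs <;> omega

/-- The inversion that is lost is the pair `(lo k, hi k)` itself. -/
theorem fullCode_mul_simple_hi {n : ℕ} {w : Perm (Fin n)} {k : Fin (n - 1)}
    (h : w (hi k) < w (lo k)) :
    fullCode (w * simpleTransposition k) (hi k) + 1 = fullCode w (lo k) := by
  rw [fullCode_mul_simple_eq, simpleTransposition_hi, fullCode]
  have : (Finset.univ.filter fun j : Fin n => lo k < j ∧ w j < w (lo k)) =
      insert (hi k) (Finset.univ.filter fun j : Fin n =>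
        hi k < simpleTransposition k j ∧ w j < w (lo k)) := by
    ext j
    simp only [Finset.mem_filter, Finset.mem_univ, true_and, Finset.mem_insert]
    by_cases hj : j = hi k
    · subst hj
      simp [h, lo_lt_hi]
    · have : (j : ℕ) ≠ k + 1 := fun e => hj (Fin.ext e)
      simp only [hj, false_or]
      refine and_congr_left fun _ => ?_
      rw [Fin.lt_def, Fin.lt_def, simple_val]
      simp only [lo, hi]
      split_ifs <;> omega
  rw [this, Finset.card_insert_of_notMem]
  simp [simpleTransposition_hi, (lo_lt_hi k).le]

theorem fullCode_mul_simple_of_ne {n : ℕ} (w : Perm (Fin n)) {k : Fin (n - 1)} {i : Fin n}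
    (h1 : i ≠ lo k) (h2 : i ≠ hi k) :
    fullCode (w * simpleTransposition k) i = fullCode w i := by
  rw [fullCode_mul_simple_eq, fullCode, simpleTransposition, swap_apply_of_ne_of_ne h1 h2,
    ← simpleTransposition]
  congr 1
  refine Finset.filter_congr fun j _ => and_congr_left fun hj => ?_
  have : (i : ℕ) ≠ k := fun e => h1 (Fin.ext e)
  have : (i : ℕ) ≠ k + 1 := fun e => h2 (Fin.ext e)
  rw [Fin.lt_def, Fin.lt_def, simple_val]
  split_ifs <;> omega

theorem fullCode_hi_lt_lo {n : ℕ} {w : Perm (Fin n)} {k : Fin (n - 1)}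
    (h : w (hi k) < w (lo k)) : fullCode w (hi k) < fullCode w (lo k) := by
  refine Finset.card_lt_card ((Finset.ssubset_iff_of_subset ?_).2 ⟨hi k, ?_, ?_⟩)
  · intro j
    simp only [Finset.mem_filter, Finset.mem_univ, true_and]
    exact fun hj => ⟨(lo_lt_hi k).trans hj.1, hj.2.trans h⟩
  · simp [h, lo_lt_hi]
  · simp

/-- At a descent, passing to `w s_k` exchanges two adjacent code entries and lowers one of them by
`1`. The codes of `w` and `v` undergo the same change, so the entrywise differences are only
permuted. -/
theorem codeDistance_mul_simple {n : ℕ} {w v : Perm (Fin n)} {k : Fin (n - 1)}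
    (hw : w (hi k) < w (lo k)) (hv : v (hi k) < v (lo k)) :
    codeDistance (w * simpleTransposition k) (v * simpleTransposition k) = codeDistance w v := by
  rw [codeDistance_eq_sum, codeDistance_eq_sum, ← Equiv.sum_comp (simpleTransposition k)]
  refine Finset.sum_congr rfl fun i _ => ?_
  by_cases h1 : i = lo k
  · subst h1
    have e1 := fullCode_mul_simple_hi hw
    have e2 := fullCode_mul_simple_hi hv
    rw [simpleTransposition_lo, ← e1, ← e2]
    push_cast
    congr 1
    ring
  by_cases h2 : i = hi k
  · subst h2
    rw [simpleTransposition_hi, fullCode_mul_simple_lo hw, fullCode_mul_simple_lo hv]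
  rw [show simpleTransposition k i = i from swap_apply_of_ne_of_ne h1 h2,
    fullCode_mul_simple_of_ne w h1 h2, fullCode_mul_simple_of_ne v h1 h2]

/-- Only two entries change: the one at `lo k` by `c_lo - c_hi`, the one at `hi k` by `c_lo - 1 -
c_hi`. Both are nonnegative by `fullCode_hi_lt_lo`. -/
theorem codeDistance_mul_simple_self {n : ℕ} {w : Perm (Fin n)} {k : Fin (n - 1)}
    (h : w (hi k) < w (lo k)) : codeDistance (w * simpleTransposition k) w =
      2 * ((fullCode w (lo k) : ℤ) - fullCode w (hi k)) - 1 := by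
  rw [codeDistance_eq_sum, Fintype.sum_eq_add (lo k) (hi k) (lo_lt_hi k).ne]
  · have h1 := fullCode_hi_lt_lo h
    have h2 := fullCode_mul_simple_hi h
    rw [fullCode_mul_simple_lo h, abs_of_nonpos (by omega), abs_of_nonneg (by omega)]
    omega
  · rintro i ⟨h1, h2⟩
    simp [fullCode_mul_simple_of_ne w h1 h2]

theorem codeDistance_self_mul_simple {n : ℕ} {w : Perm (Fin n)} {k : Fin (n - 1)}
    (h : w (lo k) < w (hi k)) : codeDistance w (w * simpleTransposition k) =
      2 * ((fullCode w (hi k) : ℤ) - fullCode w (lo k)) + 1 := by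
  have h' : (w * simpleTransposition k) (hi k) < (w * simpleTransposition k) (lo k) := by
    simpa [simpleTransposition_lo, simpleTransposition_hi] using h
  have h1 := codeDistance_mul_simple_self h'
  have h2 := fullCode_mul_simple_lo h'
  have h3 := fullCode_mul_simple_hi h'
  rw [mul_simpleTransposition_cancel] at h1 h2 h3
  rw [h1, ← h2, ← h3]
  push_cast
  ring

/-- Abel summation. For a code the last entry is `0`, which leaves minus the length. -/
theorem sum_mul_sub {m : ℕ} (c : Fin (m + 1) → ℤ) :
    ∑ k : Fin m, ((k : ℤ) + 1) * (c k.succ - c k.castSucc) =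
      (m + 1) * c (Fin.last m) - ∑ i, c i := by
  induction m with
  | zero => simp
  | succ m ih =>
    rw [Fin.sum_univ_castSucc, Fin.sum_univ_castSucc (n := m + 1)]
    have := ih fun i => c i.castSucc
    simp only [Fin.succ_castSucc, Fin.val_castSucc, Fin.val_last, Fin.succ_last] at this ⊢
    rw [this]
    push_cast
    ring

theorem sum_mul_fullCode {n : ℕ} (w : Perm (Fin n)) :
    ∑ k : Fin (n - 1), ((k : ℤ) + 1) * ((fullCode w (hi k) : ℤ) - fullCode w (lo k)) =
      -(length w : ℤ) := by
  rw [← sum_fullCode]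
  cases n with
  | zero => simp
  | succ m =>
    have := sum_mul_sub fun i => (fullCode w i : ℤ)
    rw [fullCode_eq_zero w (Fin.last m) rfl] at this
    simp only [mul_zero, Nat.cast_zero, zero_sub, Nat.cast_sum] at this ⊢
    exact this

theorem sum_succ_eq_sum_sub (n : ℕ) :
    ∑ k : Fin (n - 1), ((k : ℤ) + 1) = ∑ i : Fin n, ((n - 1 - i : ℕ) : ℤ) := by
  have := Equiv.sum_comp Fin.revPerm fun i : Fin n => ((n - 1 - i : ℕ) : ℤ)
  rw [← this]
  cases n with
  | zero => simp
  | succ m =>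
    rw [Fin.sum_univ_succ]
    simp

/-! ### The operators `∇` and Euler's operator -/

theorem derivation_rename {n : ℕ}
    (d : Derivation ℂ (MvPolynomial (Fin n) ℂ) (MvPolynomial (Fin n) ℂ))
    (σ : Perm (Fin n)) (h : ∀ i, rename σ (d (X i)) = d (X (σ i)))
    (f : MvPolynomial (Fin n) ℂ) : d (rename σ f) = rename σ (d f) := by
  induction f using MvPolynomial.induction_on with
  | C c => simp [MvPolynomial.derivation_C]
  | add p q hp hq => simp only [map_add, hp, hq]
  | mul_X p i hp =>
    simp only [map_mul, Derivation.leibniz, map_add, smul_eq_mul, rename_X, hp, h]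

/-- The operator `∇ = ∑ ∂/∂x_i`. -/
noncomputable def nabla (n : ℕ) :
    Derivation ℂ (MvPolynomial (Fin n) ℂ) (MvPolynomial (Fin n) ℂ) :=
  mkDerivation ℂ fun _ => 1

/-- Euler's operator `∑ x_i ∂/∂x_i`. -/
noncomputable def euler (n : ℕ) :
    Derivation ℂ (MvPolynomial (Fin n) ℂ) (MvPolynomial (Fin n) ℂ) :=
  mkDerivation ℂ fun i => X i

@[simp] theorem nabla_X {n : ℕ} (i : Fin n) : nabla n (X i) = 1 := mkDerivation_X _ _ _

@[simp] theorem euler_X {n : ℕ} (i : Fin n) : euler n (X i) = X i := mkDerivation_X _ _ _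

/-- `∇` commutes with `s_i` and kills `x_i - x_{i+1}`, so it passes through the quotient. -/
theorem nabla_newton {n : ℕ} (i : Fin (n - 1)) (f : MvPolynomial (Fin n) ℂ) :
    nabla n (newton i f) = newton i (nabla n f) := by
  have h := congrArg (nabla n) (divDiff_spec (lo i) (hi i) f)
  rw [map_sub, derivation_rename _ _ (by simp), ← divDiff_spec] at h
  apply mul_left_cancel₀ (X_sub_X_ne_zero (lo_lt_hi i).ne)
  simpa only [newton, Derivation.leibniz, smul_eq_mul, map_sub, nabla_X, sub_self, mul_zero,
    add_zero] using h

/-- Here the derivation fixes `x_i - x_{i+1}`, whence the correction term: `N_i` lowers the degree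
by one. -/
theorem euler_newton {n : ℕ} (i : Fin (n - 1)) (f : MvPolynomial (Fin n) ℂ) :
    euler n (newton i f) = newton i (euler n f) - newton i f := by
  have h := congrArg (euler n) (divDiff_spec (lo i) (hi i) f)
  rw [map_sub, derivation_rename _ _ (by simp), ← divDiff_spec] at h
  apply mul_left_cancel₀ (X_sub_X_ne_zero (lo_lt_hi i).ne)
  simp only [Derivation.leibniz, smul_eq_mul, map_sub, euler_X] at h
  simp only [newton]
  linear_combination h

/-- The divided difference operator `N_i` as a linear map. -/
noncomputable def newtonLinear {n : ℕ} (i : Fin (n - 1)) :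
    MvPolynomial (Fin n) ℂ →ₗ[ℂ] MvPolynomial (Fin n) ℂ where
  toFun := newton i
  map_add' f g := by
    apply mul_left_cancel₀ (X_sub_X_ne_zero (lo_lt_hi i).ne)
    rw [mul_add]
    simp only [newton, divDiff_spec, map_add]
    ring
  map_smul' c f := by
    apply mul_left_cancel₀ (X_sub_X_ne_zero (lo_lt_hi i).ne)
    rw [mul_smul_comm]
    simp only [newton, divDiff_spec, map_smul, smul_sub, RingHom.id_apply]

theorem newtonLinear_apply {n : ℕ} (i : Fin (n - 1)) (f : MvPolynomial (Fin n) ℂ) :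
    newtonLinear i f = newton i f := rfl

theorem newton_newton {n : ℕ} (i : Fin (n - 1)) (f : MvPolynomial (Fin n) ℂ) :
    newton i (newton i f) = 0 := by
  have h := divDiff_spec (lo i) (hi i) (newton i f)
  rw [newton, rename_divDiff (lo_lt_hi i).ne, sub_self] at h
  exact (mul_eq_zero.1 h).resolve_left (X_sub_X_ne_zero (lo_lt_hi i).ne)

-- Without a left descent at `i`, `𝔖_w` is itself an image of `N_i`, and `N_i² = 0`.
open Classical in
theorem newton_schubert {n : ℕ} (i : Fin (n - 1)) (w : Perm (Fin n)) :
    newton i (schubert w) = if length (simpleTransposition i * w) < length w then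
      schubert (simpleTransposition i * w) else 0 := by
  split_ifs with h
  · exact (schubert_simpleTransposition_mul i w h).symm
  · rw [length_descent_iff] at h
    have h1 := length_ascent ((ascent_or_descent i w).resolve_right h)
    have h2 := schubert_simpleTransposition_mul i (simpleTransposition i * w) (by
      rw [simpleTransposition_mul_cancel]; omega)
    rw [simpleTransposition_mul_cancel] at h2
    rw [h2, newton_newton]

/-- The exponent `ρ`, as an exponent of a monomial in `n` variables. -/
noncomputable def rho (n : ℕ) : Fin n →₀ ℕ := Finsupp.equivFunOnFinite.symm fun i => n - 1 - i

@[simp] theorem rho_apply {n : ℕ} (i : Fin n) : rho n i = n - 1 - i := rfl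

/-! ### Schubert polynomials under `∇` and Euler's operator -/

theorem monomial_eq_prod {n : ℕ} (a : Fin n →₀ ℕ) :
    (monomial a 1 : MvPolynomial (Fin n) ℂ) = ∏ i, X i ^ a i := by
  rw [monomial_eq, C_1, one_mul, Finsupp.prod_fintype _ _ fun _ => pow_zero _]

theorem prod_lo {M : Type*} [CommMonoid M] {n : ℕ} (f : Fin n → M)
    (h : ∀ i : Fin n, (i : ℕ) + 1 = n → f i = 1) : ∏ i : Fin (n - 1), f (lo i) = ∏ i, f i := by
  cases n with
  | zero => simp
  | succ m =>
    rw [Fin.prod_univ_castSucc, h (Fin.last m) rfl, mul_one]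
    rfl

theorem schubert_longest_eq_monomial (n : ℕ) : schubert (longest n) = monomial (rho n) 1 := by
  rw [schubert_longest, monomial_eq_prod, ← prod_lo fun i : Fin n => X i ^ rho n i]
  · rfl
  · intro i h
    rw [rho_apply, show n - 1 - (i : ℕ) = 0 by omega, pow_zero]

theorem derivation_monomial {n : ℕ} (g : Fin n → MvPolynomial (Fin n) ℂ) (a : Fin n →₀ ℕ) :
    mkDerivation ℂ g (monomial a 1) =
      ∑ i, (a i : ℂ) • (monomial (a - Finsupp.single i 1) 1 * g i) := by
  rw [mkDerivation_monomial, one_smul, Finsupp.sum_fintype]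
  · refine Finset.sum_congr rfl fun i _ => ?_
    rw [smul_eq_mul, ← smul_mul_assoc, smul_monomial, smul_eq_mul, mul_one]
  · simp

theorem nabla_monomial {n : ℕ} (a : Fin n →₀ ℕ) :
    nabla n (monomial a 1) = ∑ i, (a i : ℂ) • monomial (a - Finsupp.single i 1) 1 := by
  simp only [nabla, derivation_monomial, mul_one]

theorem euler_monomial {n : ℕ} (a : Fin n →₀ ℕ) :
    euler n (monomial a 1) = ((∑ i, a i : ℕ) : ℂ) • monomial a 1 := by
  rw [euler, derivation_monomial, Nat.cast_sum, Finset.sum_smul]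
  refine Finset.sum_congr rfl fun i _ => ?_
  by_cases h : a i = 0
  · simp [h]
  · rw [X, monomial_mul, tsub_add_cancel_of_le, one_mul]
    simpa using Nat.one_le_iff_ne_zero.2 h

/-- The monomial is `x_i` times a monomial symmetric in `x_i` and `x_{i+1}`, and `N_i x_i = 1`. -/
theorem newton_monomial {n : ℕ} (i : Fin (n - 1)) (a : Fin n →₀ ℕ) (h : a (lo i) = a (hi i) + 1) :
    newton i (monomial a 1) = monomial (a - Finsupp.single (lo i) 1) 1 := by
  have ha : a - Finsupp.single (lo i) 1 + Finsupp.single (lo i) 1 = a := by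
    apply tsub_add_cancel_of_le
    simp [h]
  set b := a - Finsupp.single (lo i) 1 with hb
  have hne := (lo_lt_hi i).ne
  have hb1 : b (lo i) = b (hi i) := by simp [hb, h, hne]
  have hm : (monomial a 1 : MvPolynomial (Fin n) ℂ) = monomial b 1 * X (lo i) := by
    rw [X, monomial_mul, ha, one_mul]
  have hr : rename (swap (lo i) (hi i)) (monomial b 1 : MvPolynomial (Fin n) ℂ) =
      monomial b 1 := by
    rw [rename_monomial]
    congr 2
    ext x
    rw [Finsupp.mapDomain_equiv_apply, symm_swap, swap_apply_def]
    split_ifs with h1 h2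
    · rw [h1, hb1]
    · rw [h2, hb1]
    · rfl
  apply mul_left_cancel₀ (X_sub_X_ne_zero hne)
  rw [newton, divDiff_spec, hm, map_mul, hr, rename_X, swap_apply_left]
  ring

theorem longest_mul_simple {n : ℕ} (k : Fin (n - 1)) :
    longest n * simpleTransposition k = simpleTransposition k.rev * longest n := by
  have h1 : longest n (lo k) = hi k.rev := by
    ext; simp [longest, lo, hi]; omega
  have h2 : longest n (hi k) = lo k.rev := by
    ext; simp [longest, lo, hi]; omega
  rw [simpleTransposition, mul_swap_eq_swap_mul, h1, h2, swap_comm, simpleTransposition]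

theorem length_longest_mul_lt {n : ℕ} (k : Fin (n - 1)) :
    length (longest n * simpleTransposition k) < length (longest n) := by
  rw [length_mul_simple_lt_iff]
  simp [longest, lo_lt_hi]

-- Left multiplication by `s_i` (from `N_i`) and right multiplication by `s_k` commute, so the
-- formula propagates down from `w₀`, where it is the derivative of `x^ρ`.
open Classical in
theorem nabla_schubert {n : ℕ} (w : Perm (Fin n)) : nabla n (schubert w) =
    ∑ k : Fin (n - 1), if length (w * simpleTransposition k) < length w then
      ((k : ℂ) + 1) • schubert (w * simpleTransposition k) else 0 := by
  have hS := isSchubert_schubert w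
  generalize schubert w = f at hS
  induction hS with
  | top =>
    have h0 := schubert_longest_eq_monomial n
    rw [schubert_longest] at h0
    rw [h0, nabla_monomial, ← sum_lo, ← Equiv.sum_comp Fin.revPerm]
    · refine Finset.sum_congr rfl fun k _ => ?_
      rw [if_pos (length_longest_mul_lt k)]
      have h1 := length_longest_mul_lt k
      -- Since `w₀ s_k = s_{rev k} w₀`, the term of `s_k` is the derivative in the variable with
      -- index `rev k`, whose exponent in `x^ρ` is `k + 1`; this is the source of the weights.
      rw [longest_mul_simple] at h1 ⊢
      rw [schubert_simpleTransposition_mul _ _ h1, schubert_longest_eq_monomial, newton_monomial]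
      · congr 1
        rw [rho_apply]
        have : n - 1 - ((lo (Fin.revPerm k) : Fin n) : ℕ) = k + 1 := by
          simp [lo]; omega
        rw [this]
        push_cast
        rfl
      · simp only [rho_apply, lo, hi]
        have := k.rev.2
        omega
    · intro i h
      rw [rho_apply, show n - 1 - (i : ℕ) = 0 by omega, Nat.cast_zero, zero_smul]
  | @step w g i hg hl ih =>
    rw [nabla_newton, ih, ← newtonLinear_apply, map_sum]
    refine Finset.sum_congr rfl fun k _ => ?_
    rw [mul_assoc]
    have e : ∀ u : Perm (Fin n), (length (simpleTransposition i * u) = length u + 1 ∨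
        length (simpleTransposition i * u) + 1 = length u) := fun u => by
      simp only [length_eq_card_inversions]
      exact (ascent_or_descent i u).imp (card_inversions_of_ascent i u)
        (card_inversions_of_descent i u)
    have e' : ∀ u : Perm (Fin n), (length (u * simpleTransposition k) = length u + 1 ∨
        length (u * simpleTransposition k) + 1 = length u) := fun u =>
      (apply_lo_lt_or_gt u k).imp length_mul_simple_of_lt length_mul_simple_of_gt
    have e1 := e w
    have e2 := e (w * simpleTransposition k)
    have e3 := e' w
    have e4 := e' (simpleTransposition i * w)
    rw [mul_assoc] at e4
    -- Each multiplication changes the length by exactly one. Given that `s_i` shortens `w` on the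
    -- left, a term survives on either side exactly when `s_i w s_k` is shorter than `w` by two.
    by_cases h1 : length (w * simpleTransposition k) < length w
    · rw [if_pos h1, map_smul, newtonLinear_apply, newton_schubert]
      by_cases h2 : length (simpleTransposition i * (w * simpleTransposition k)) <
          length (w * simpleTransposition k)
      · rw [if_pos h2, if_pos (by omega)]
      · rw [if_neg h2, if_neg (by omega), smul_zero]
    · rw [if_neg h1, map_zero, if_neg (by omega)]

theorem euler_schubert {n : ℕ} (w : Perm (Fin n)) :
    euler n (schubert w) = (length w : ℂ) • schubert w := by
  have hS := isSchubert_schubert w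
  generalize schubert w = f at hS
  induction hS with
  | top =>
    have h0 := schubert_longest_eq_monomial n
    rw [schubert_longest] at h0
    rw [h0, euler_monomial, ← sum_fullCode]
    simp only [fullCode_longest, rho_apply]
  | @step w g i hg hl ih =>
    have h := length_ascent ((ascent_or_descent i (simpleTransposition i * w)).resolve_right (by
      rw [← length_descent_iff, simpleTransposition_mul_cancel]; omega))
    rw [simpleTransposition_mul_cancel] at h
    rw [euler_newton, ih, h, ← newtonLinear_apply, map_smul]
    rw [newtonLinear_apply]
    push_cast
    module

/-! ### Linear independence -/

theorem eval_zero_schubert {n : ℕ} {w : Perm (Fin n)} (h : w ≠ 1) :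
    eval (0 : Fin n → ℂ) (schubert w) = 0 := by
  have key : ∀ f : MvPolynomial (Fin n) ℂ, eval (0 : Fin n → ℂ) (euler n f) = 0 := fun f => by
    induction f using MvPolynomial.induction_on with
    | C c => rw [MvPolynomial.derivation_C, map_zero]
    | add p q hp hq => rw [map_add, map_add, hp, hq, add_zero]
    | mul_X p i _ => simp [Derivation.leibniz]
  have h1 := key (schubert w)
  rw [euler_schubert, smul_eval] at h1
  refine (mul_eq_zero.1 h1).resolve_left ?_
  obtain ⟨i, hi⟩ := exists_descent h
  have := length_descent_iff.2 hi
  exact_mod_cast (by omega : length w ≠ 0)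

/-- If `𝔖_1` vanished, setting all variables equal would kill every `𝔖_w`, by induction on length:
the derivative vanishes by the formula for `∇`, and the constant term by homogeneity. But `x^ρ`
specializes to a power of the variable. -/
theorem schubert_one_ne_zero (n : ℕ) : schubert (1 : Perm (Fin n)) ≠ 0 := by
  intro h0
  let φ : MvPolynomial (Fin n) ℂ →ₐ[ℂ] Polynomial ℂ := aeval fun _ => Polynomial.X
  have hφ : ∀ f, φ (nabla n f) = Polynomial.derivative (φ f) := fun f => by
    induction f using MvPolynomial.induction_on with
    | C c => simp [MvPolynomial.derivation_C, φ, Polynomial.algebraMap_eq]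
    | add p q hp hq => simp [hp, hq]
    | mul_X p i hp => simp [Derivation.leibniz, hp, φ]; ring
  have hev : ∀ f, (φ f).eval 0 = eval (0 : Fin n → ℂ) f := fun f => by
    induction f using MvPolynomial.induction_on with
    | C c => simp [φ, Polynomial.algebraMap_eq]
    | add p q hp hq => simp [hp, hq]
    | mul_X p i hp => simp [φ]
  have key : ∀ (k : ℕ) (w : Perm (Fin n)), length w ≤ k → φ (schubert w) = 0 := by
    intro k
    induction k with
    | zero =>
      intro w hw
      have : w = 1 := by
        by_contra hne
        obtain ⟨i, hi⟩ := exists_descent hne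
        have := length_descent_iff.2 hi
        omega
      rw [this, h0, map_zero]
    | succ k ih =>
      intro w hw
      by_cases hne : w = 1
      · rw [hne, h0, map_zero]
      have h1 : Polynomial.derivative (φ (schubert w)) = 0 := by
        classical
        rw [← hφ, nabla_schubert, map_sum]
        refine Finset.sum_eq_zero fun i _ => ?_
        split_ifs with hi
        · rw [map_smul, ih _ (by omega), smul_zero]
        · rw [map_zero]
      have h2 := Polynomial.eq_C_of_derivative_eq_zero h1
      rw [h2, Polynomial.coeff_zero_eq_eval_zero, hev, eval_zero_schubert hne, map_zero]
  have := key _ (longest n) le_rfl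
  rw [schubert_longest, map_prod] at this
  simp [φ, Finset.prod_eq_zero_iff] at this

/-- For `w ≠ 1`, applying `N_i` at a left descent of `w` yields a relation among shorter
permutations in which the coefficient of `w` survives. Only `𝔖_1 ≠ 0` is left over. -/
theorem linearIndependent_schubert (n : ℕ) :
    LinearIndependent ℂ (schubert : Perm (Fin n) → MvPolynomial (Fin n) ℂ) := by
  rw [Fintype.linearIndependent_iff]
  have one : ∀ a : Perm (Fin n) → ℂ, ∑ w, a w • schubert w = 0 → (∀ w, w ≠ 1 → a w = 0) →
      ∀ w, a w = 0 := by
    intro a ha h1 w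
    by_cases hw : w = 1
    · subst hw
      rw [Finset.sum_eq_single 1 (fun w _ hw => by rw [h1 w hw, zero_smul]) (by simp)] at ha
      exact (smul_eq_zero.1 ha).resolve_right (schubert_one_ne_zero n)
    · exact h1 w hw
  have key : ∀ (k : ℕ) (a : Perm (Fin n) → ℂ), (∀ w, k < length w → a w = 0) →
      ∑ w, a w • schubert w = 0 → ∀ w, a w = 0 := by
    intro k
    induction k with
    | zero =>
      intro a ha hs
      refine one a hs fun w hw => ?_
      obtain ⟨i, hi⟩ := exists_descent hw
      have := length_descent_iff.2 hi
      exact ha w (by omega)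
    | succ k ih =>
      intro a ha hs
      refine one a hs fun w hw => ?_
      obtain ⟨i, hi⟩ := exists_descent hw
      have hi' := length_descent_iff.2 hi
      have hN := congrArg (newtonLinear i) hs
      rw [map_zero, map_sum, ← Equiv.sum_comp (Equiv.mulLeft (simpleTransposition i))] at hN
      -- The coefficient of `𝔖_u` after applying `N_i` is that of `s_i u`, provided that `s_i`
      -- lengthens `u`.
      have h2 := ih (fun u => if length u < length (simpleTransposition i * u) then
        a (simpleTransposition i * u) else 0) ?_ ?_ (simpleTransposition i * w)
      · simpa only [simpleTransposition_mul_cancel, hi', if_true] using h2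
      · intro u hu
        split_ifs with h
        · exact ha _ (by omega)
        · rfl
      · rw [← hN]
        refine Finset.sum_congr rfl fun u _ => ?_
        rw [Equiv.coe_mulLeft, map_smul, newtonLinear_apply, newton_schubert,
          simpleTransposition_mul_cancel]
        split_ifs with h
        · rfl
        · rw [zero_smul, smul_zero]
  exact fun a ha => key (n * n) a (fun w hw => absurd (length_le w) (by omega)) ha

/-! ### Uniqueness of the raising operator -/

/-- If `E`, `N` and `U`, `D` are the raising and lowering operators of two `sl₂`-actions, then a
graded map that intertwines the lowering operators also intertwines the raising operators, as soon
as the target has no vectors of large degree. -/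
theorem raising_intertwines {W P : Type*} [AddCommGroup W] [Module ℂ W] [AddCommGroup P]
    [Module ℂ P] (E N H : P →ₗ[ℂ] P) (U D L : W →ₗ[ℂ] W) (Φ : W →ₗ[ℂ] P) (c : ℂ)
    (hNE : ∀ p, N (E p) = E (N p) + (c • p - (2 : ℂ) • H p)) (hHE : ∀ p, H (E p) = E (H p) + E p)
    (hDU : ∀ x, D (U x) = U (D x) + (c • x - (2 : ℂ) • L x)) (hLU : ∀ x, L (U x) = U (L x) + U x)
    (hNΦ : ∀ x, N (Φ x) = Φ (D x)) (hHΦ : ∀ x, H (Φ x) = Φ (L x))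
    (V : Submodule ℂ P) (hEV : ∀ p ∈ V, E p ∈ V) (hΦV : ∀ x, Φ x ∈ V)
    (K : ℕ) (hK : ∀ Y : W →ₗ[ℂ] P, (∀ x, Y x ∈ V) →
      (∀ x, H (Y x) = Y (L x) + (K : ℂ) • Y x) → Y = 0) (x : W) : E (Φ x) = Φ (U x) := by
  -- `Y k` is the `k`-fold commutator of `E` and `U` applied to `Φ`; the claim is `Y 1 = 0`.
  obtain ⟨Y, e, hY⟩ : ∃ Y : ℕ → (W →ₗ[ℂ] P), (∀ x, Y 0 x = Φ x) ∧
      ∀ k x, Y (k + 1) x = E (Y k x) - Y k (U x) :=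
    ⟨fun k => Nat.rec Φ (fun _ Z => E ∘ₗ Z - Z ∘ₗ U) k, fun _ => rfl, fun _ _ => rfl⟩
  have hV : ∀ k x, Y k x ∈ V := by
    intro k
    induction k with
    | zero => exact fun x => e x ▸ hΦV x
    | succ k ih =>
      intro x
      rw [hY]
      exact V.sub_mem (hEV _ (ih x)) (ih _)
  have hH : ∀ k x, H (Y k x) = Y k (L x) + (k : ℂ) • Y k x := by
    intro k
    induction k with
    | zero =>
      intro x
      rw [Nat.cast_zero, zero_smul, add_zero, e, e, hHΦ]
    | succ k ih =>
      intro x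
      rw [hY, hY, map_sub, hHE, ih, ih, hLU, map_add, map_add, map_smul]
      push_cast
      module
  have hN0 : ∀ x, N (Y 1 x) = Y 1 (D x) := by
    intro x
    have e1 : ∀ x, Y 1 x = E (Y 0 x) - Y 0 (U x) := hY 0
    rw [e1, e1, map_sub, hNE]
    simp only [e, hNΦ, hHΦ, hDU, map_add, map_sub, map_smul]
    module
  -- `Y 1` commutes with the lowering operators and has weight `2`, since `c` cancels in the action
  -- on linear maps. The factor `(k+1)(k+2)` is the usual `sl₂` coefficient; being nonzero, it lets
  -- `Y (k+2) = 0` force `Y (k+1) = 0`.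
  have hN : ∀ k x, N (Y (k + 2) x) =
      Y (k + 2) (D x) - (((k : ℂ) + 1) * ((k : ℂ) + 2)) • Y (k + 1) x := by
    intro k
    induction k with
    | zero =>
      intro x
      have e2 : ∀ x, Y (0 + 2) x = E (Y 1 x) - Y 1 (U x) := hY 1
      rw [e2, e2, map_sub, hNE, hN0, hN0, hH, hDU, zero_add]
      simp only [map_add, map_sub, map_smul]
      push_cast
      module
    | succ k ih =>
      intro x
      have e2 : ∀ x, Y (k + 1 + 2) x = E (Y (k + 2) x) - Y (k + 2) (U x) := hY (k + 2)
      have e3 : E (Y (k + 1) x) = Y (k + 2) x + Y (k + 1) (U x) := by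
        rw [hY (k + 1), sub_add_cancel]
      rw [e2, e2, map_sub, hNE, ih, ih, hH (k + 2), hDU, add_assoc k 1 1]
      simp only [map_add, map_sub, map_smul, e3]
      push_cast
      module
  have hdesc : ∀ k, Y (k + 1) = 0 → Y 1 = 0 := by
    intro k
    induction k with
    | zero => exact id
    | succ k ih =>
      intro h
      refine ih (LinearMap.ext fun x => ?_)
      have h1 := hN k x
      rw [h] at h1
      simp only [LinearMap.zero_apply, map_zero, zero_sub] at h1
      refine (smul_eq_zero.1 (neg_eq_zero.1 h1.symm)).resolve_left ?_
      exact mul_ne_zero (by exact_mod_cast k.succ_ne_zero) (by exact_mod_cast (k + 1).succ_ne_zero)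
  have hz : Y K = 0 := hK _ (hV K) (hH K)
  have h1 : Y 1 = 0 := by
    refine hdesc K (LinearMap.ext fun x => ?_)
    rw [hY, hz]
    simp
  have h2 := LinearMap.congr_fun h1 x
  rw [hY 0, e, e] at h2
  exact sub_eq_zero.1 h2

/-! ### The raising operator on polynomials -/

/-- The operator that becomes `Δ` after padding. -/
noncomputable def raising (n : ℕ) : MvPolynomial (Fin n) ℂ →ₗ[ℂ] MvPolynomial (Fin n) ℂ :=
  LinearMap.mulLeft ℂ (∑ i, (rho n i : ℂ) • X i) -
    (mkDerivation ℂ fun i : Fin n => (X i ^ 2 : MvPolynomial (Fin n) ℂ)).toLinearMap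

theorem raising_apply {n : ℕ} (f : MvPolynomial (Fin n) ℂ) : raising n f =
    (∑ i, (rho n i : ℂ) • X i) * f -
      mkDerivation ℂ (fun i : Fin n => (X i ^ 2 : MvPolynomial (Fin n) ℂ)) f := rfl

/-- `∇` maps `∑ ρ_i x_i` to `|ρ|`, and its commutator with `∑ x_i² ∂/∂x_i` is twice Euler's
operator. -/
theorem nabla_raising {n : ℕ} (f : MvPolynomial (Fin n) ℂ) : nabla n (raising n f) =
    raising n (nabla n f) + (((∑ i, rho n i : ℕ) : ℂ) • f - (2 : ℂ) • euler n f) := by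
  have key : nabla n (mkDerivation ℂ (fun i : Fin n => (X i ^ 2 : MvPolynomial (Fin n) ℂ)) f) =
      mkDerivation ℂ (fun i : Fin n => (X i ^ 2 : MvPolynomial (Fin n) ℂ)) (nabla n f) +
        2 * euler n f := by
    induction f using MvPolynomial.induction_on with
    | C c => simp [MvPolynomial.derivation_C]
    | add p q hp hq => simp only [map_add, hp, hq]; ring
    | mul_X p i hp =>
      simp only [Derivation.leibniz, map_add, smul_eq_mul, nabla_X, euler_X, mkDerivation_X, hp,
        Derivation.leibniz_pow, mul_one]
      simp only [nsmul_eq_mul]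
      push_cast
      ring
  have hM : nabla n (∑ i, (rho n i : ℂ) • X i) = C ((∑ i, rho n i : ℕ) : ℂ) := by
    simp [map_sum, smul_eq_C_mul]
  rw [raising_apply, raising_apply, map_sub, key, Derivation.leibniz, hM, smul_eq_mul, smul_eq_mul,
    smul_eq_C_mul, smul_eq_C_mul, map_ofNat]
  ring

theorem euler_raising {n : ℕ} (f : MvPolynomial (Fin n) ℂ) : euler n (raising n f) =
    raising n (euler n f) + raising n f := by
  have key : euler n (mkDerivation ℂ (fun i : Fin n => (X i ^ 2 : MvPolynomial (Fin n) ℂ)) f) =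
      mkDerivation ℂ (fun i : Fin n => (X i ^ 2 : MvPolynomial (Fin n) ℂ)) (euler n f) +
        mkDerivation ℂ (fun i : Fin n => (X i ^ 2 : MvPolynomial (Fin n) ℂ)) f := by
    induction f using MvPolynomial.induction_on with
    | C c => simp [MvPolynomial.derivation_C]
    | add p q hp hq => simp only [map_add, hp, hq]; ring
    | mul_X p i hp =>
      simp only [Derivation.leibniz, map_add, smul_eq_mul, euler_X, mkDerivation_X, hp,
        Derivation.leibniz_pow]
      simp only [nsmul_eq_mul]
      push_cast
      ring
  have hM : euler n (∑ i, (rho n i : ℂ) • X i) = ∑ i, (rho n i : ℂ) • X i := by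
    simp [map_sum]
  rw [raising_apply, raising_apply, map_sub, key, Derivation.leibniz, hM, smul_eq_mul, smul_eq_mul]
  ring

/-- The coefficient vanishes exactly when `a i = ρ_i`, so `raising` never leaves the staircase span.
-/
theorem raising_monomial {n : ℕ} (a : Fin n →₀ ℕ) : raising n (monomial a 1) =
    ∑ i, ((rho n i : ℂ) - a i) • monomial (a + Finsupp.single i 1) 1 := by
  rw [raising_apply, derivation_monomial, Finset.sum_mul, ← Finset.sum_sub_distrib]
  refine Finset.sum_congr rfl fun i _ => ?_
  rw [sub_smul, smul_mul_assoc]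
  congr 1
  · rw [X, monomial_mul, one_mul, add_comm]
  · by_cases h : a i = 0
    · simp [h]
    · rw [X_pow_eq_monomial, monomial_mul, one_mul]
      congr 3
      ext j
      by_cases hj : j = i
      · subst hj; simp; omega
      · simp [Ne.symm hj]

/-- The span of the `x^α` with `α ≤ ρ`. -/
noncomputable def staircaseSpace (n : ℕ) : Submodule ℂ (MvPolynomial (Fin n) ℂ) :=
  Submodule.span ℂ ((fun a => monomial a 1) '' Set.Iic (rho n))

theorem mem_staircaseSpace_iff {n : ℕ} {f : MvPolynomial (Fin n) ℂ} :
    f ∈ staircaseSpace n ↔ ∀ a ∈ f.support, a ≤ rho n := by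
  constructor
  · intro hf
    induction hf using Submodule.span_induction with
    | mem x hx =>
      obtain ⟨b, hb, rfl⟩ := hx
      intro a ha
      rw [Finset.mem_singleton.1 (support_monomial_subset ha)]
      exact hb
    | zero => simp
    | add x y _ _ hx hy =>
      classical
      intro a ha
      exact (Finset.mem_union.1 (support_add ha)).elim (hx a) (hy a)
    | smul c x _ hx => exact fun a ha => hx a (support_smul ha)
  · intro h
    rw [f.as_sum]
    refine Submodule.sum_mem _ fun a ha => ?_
    have := (staircaseSpace n).smul_mem (coeff a f) (Submodule.subset_span ⟨a, h a ha, rfl⟩)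
    simpa [smul_monomial] using this

theorem schubert_mem_staircaseSpace {n : ℕ} (w : Perm (Fin n)) :
    schubert w ∈ staircaseSpace n := by
  rw [mem_staircaseSpace_iff]
  intro a ha k
  exact (monomial_le_degreeOf k ha).trans (degreeOf_schubert_le w k)

theorem monomial_add_single_mem {n : ℕ} {a : Fin n →₀ ℕ} (ha : a ≤ rho n) (i : Fin n) :
    ((rho n i : ℂ) - a i) • (monomial (a + Finsupp.single i 1) 1 : MvPolynomial (Fin n) ℂ) ∈
      staircaseSpace n := by
  by_cases h : a i = rho n i
  · simp [h]
  · refine Submodule.smul_mem _ _ (Submodule.subset_span ⟨_, fun j => ?_, rfl⟩)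
    have := ha j
    by_cases hj : i = j
    · subst hj
      rw [Finsupp.add_apply, Finsupp.single_eq_same]
      omega
    · simpa [Finsupp.single_apply, hj] using this

theorem raising_mem_staircaseSpace {n : ℕ} {f : MvPolynomial (Fin n) ℂ}
    (hf : f ∈ staircaseSpace n) : raising n f ∈ staircaseSpace n := by
  induction hf using Submodule.span_induction with
  | mem x hx =>
    obtain ⟨a, ha, rfl⟩ := hx
    dsimp only
    rw [raising_monomial]
    exact Submodule.sum_mem _ fun i _ => monomial_add_single_mem ha i
  | zero => simp
  | add x y _ _ hx hy => rw [map_add]; exact Submodule.add_mem _ hx hy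
  | smul c x _ hx => rw [map_smul]; exact Submodule.smul_mem _ _ hx

theorem coeff_euler {n : ℕ} (a : Fin n →₀ ℕ) (f : MvPolynomial (Fin n) ℂ) :
    coeff a (euler n f) = ((∑ i, a i : ℕ) : ℂ) * coeff a f := by
  classical
  induction f using MvPolynomial.induction_on' with
  | monomial b c =>
    have : (monomial b c : MvPolynomial (Fin n) ℂ) = c • monomial b 1 := by
      rw [smul_monomial, smul_eq_mul, mul_one]
    rw [this, Derivation.map_smul, euler_monomial]
    simp only [coeff_smul, coeff_monomial, smul_eq_mul]
    split_ifs with h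
    · rw [h]; ring
    · simp
  | add p q hp hq => rw [map_add, coeff_add, coeff_add, hp, hq, mul_add]

theorem eq_zero_of_euler_eq {n : ℕ} {f : MvPolynomial (Fin n) ℂ} (hf : f ∈ staircaseSpace n)
    {d : ℕ} (hd : ∑ i, rho n i < d) (h : euler n f = (d : ℂ) • f) : f = 0 := by
  rw [mem_staircaseSpace_iff] at hf
  by_contra hne
  obtain ⟨a, ha⟩ := support_nonempty.2 hne
  have h1 := congrArg (coeff a) h
  rw [coeff_euler, coeff_smul, smul_eq_mul] at h1
  have h2 : ∑ i, a i = d := by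
    exact_mod_cast mul_right_cancel₀ (mem_support_iff.1 ha) h1
  have h3 : ∑ i, a i ≤ ∑ i, rho n i := Finset.sum_le_sum fun i _ => hf a ha i
  omega

/-! ### The operators on permutations -/

open Classical in
/-- The weighted down operator of the right weak order. -/
noncomputable def weakDown (n : ℕ) : (Perm (Fin n) →₀ ℂ) →ₗ[ℂ] (Perm (Fin n) →₀ ℂ) :=
  Finsupp.linearCombination ℂ fun w => ∑ k : Fin (n - 1),
    if length (w * simpleTransposition k) < length w then
      ((k : ℂ) + 1) • Finsupp.single (w * simpleTransposition k) 1 else 0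

open Classical in
/-- The weighted up operator of the strong Bruhat order. -/
noncomputable def strongUp (n : ℕ) : (Perm (Fin n) →₀ ℂ) →ₗ[ℂ] (Perm (Fin n) →₀ ℂ) :=
  Finsupp.linearCombination ℂ fun w => ∑ v : Perm (Fin n),
    if StrongCover w v then (codeDistance w v : ℂ) • Finsupp.single v 1 else 0

/-- The operator multiplying a permutation by its length. -/
noncomputable def lengthOp (n : ℕ) : (Perm (Fin n) →₀ ℂ) →ₗ[ℂ] (Perm (Fin n) →₀ ℂ) :=
  Finsupp.linearCombination ℂ fun w => (length w : ℂ) • Finsupp.single w 1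

open Classical in
theorem weakDown_single {n : ℕ} (w : Perm (Fin n)) : weakDown n (Finsupp.single w 1) =
    ∑ k : Fin (n - 1), if length (w * simpleTransposition k) < length w then
      ((k : ℂ) + 1) • Finsupp.single (w * simpleTransposition k) 1 else 0 := by
  rw [weakDown, Finsupp.linearCombination_single, one_smul]

open Classical in
theorem strongUp_single {n : ℕ} (w : Perm (Fin n)) : strongUp n (Finsupp.single w 1) =
    ∑ v : Perm (Fin n),
      if StrongCover w v then (codeDistance w v : ℂ) • Finsupp.single v 1 else 0 := by
  rw [strongUp, Finsupp.linearCombination_single, one_smul]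

theorem lengthOp_single {n : ℕ} (w : Perm (Fin n)) : lengthOp n (Finsupp.single w 1) =
    (length w : ℂ) • Finsupp.single w 1 := by
  rw [lengthOp, Finsupp.linearCombination_single, one_smul]

theorem lengthOp_strongUp {n : ℕ} (x : Perm (Fin n) →₀ ℂ) :
    lengthOp n (strongUp n x) = strongUp n (lengthOp n x) + strongUp n x := by
  have : lengthOp n ∘ₗ strongUp n = strongUp n ∘ₗ lengthOp n + strongUp n := by
    refine Finsupp.lhom_ext' fun w => LinearMap.ext_ring ?_
    classical
    simp only [LinearMap.comp_apply, LinearMap.add_apply, Finsupp.lsingle_apply, lengthOp_single,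
      map_smul, strongUp_single, map_sum, Finset.smul_sum, ← Finset.sum_add_distrib]
    refine Finset.sum_congr rfl fun v _ => ?_
    split_ifs with h
    · rw [map_smul, lengthOp_single, h.2]
      push_cast
      module
    · simp
  exact LinearMap.congr_fun this x

theorem strongCover_simple_iff {n : ℕ} {w : Perm (Fin n)} {k : Fin (n - 1)} :
    StrongCover w (w * simpleTransposition k) ↔ w (lo k) < w (hi k) := by
  constructor
  · intro h
    by_contra hc
    have := length_mul_simple_of_gt ((apply_lo_lt_or_gt w k).resolve_left hc)
    have := h.2
    omega
  · exact fun h => ⟨⟨_, _, lo_lt_hi k, rfl⟩, length_mul_simple_of_lt h⟩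

open Classical in
/-- The contributions of `v` and of the simple transposition `s_k` to the two compositions. -/
theorem up_down_term {n : ℕ} (w v : Perm (Fin n)) (k : Fin (n - 1)) :
    (if StrongCover w v ∧ v (hi k) < v (lo k) then codeDistance w v else 0) =
    (if w (hi k) < w (lo k) ∧
        StrongCover (w * simpleTransposition k) (v * simpleTransposition k) then
      codeDistance (w * simpleTransposition k) (v * simpleTransposition k) else 0) +
    if v = w * simpleTransposition k then
      2 * ((fullCode w (hi k) : ℤ) - fullCode w (lo k)) + 1 else 0 := by
  by_cases hv : v = w * simpleTransposition k
  · subst hv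
    have h2 : StrongCover (w * simpleTransposition k) w ↔ w (hi k) < w (lo k) := by
      simpa only [mul_simpleTransposition_cancel, Perm.mul_apply, simpleTransposition_lo,
        simpleTransposition_hi] using
        strongCover_simple_iff (w := w * simpleTransposition k) (k := k)
    simp only [Perm.mul_apply, simpleTransposition_lo, simpleTransposition_hi,
      mul_simpleTransposition_cancel, strongCover_simple_iff, h2, and_self, if_true]
    rcases apply_lo_lt_or_gt w k with h | h
    · simp only [h, h.not_gt, if_true, if_false, codeDistance_self_mul_simple h, zero_add]
    · simp only [h, h.not_gt, if_true, if_false, codeDistance_mul_simple_self h]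
      ring
  · rw [if_neg hv, add_zero]
    have h := strongCover_mul_simple_iff hv
    by_cases hc : StrongCover w v ∧ v (hi k) < v (lo k)
    · rw [if_pos hc, if_pos (h.1 hc), codeDistance_mul_simple (h.1 hc).1 hc.2]
    · rw [if_neg hc, if_neg (fun h' => hc (h.2 h'))]

/-- By `up_down_term` the commutator is diagonal. Its entry at `w` is `∑ k (2 (c_{k+1} - c_k) + 1)`,
with `k` counted from `1` and `c` the code of `w`, which equals `|ρ| - 2 ℓ(w)`. -/
theorem weakDown_strongUp {n : ℕ} (x : Perm (Fin n) →₀ ℂ) :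
    weakDown n (strongUp n x) = strongUp n (weakDown n x) +
      (((∑ i, rho n i : ℕ) : ℂ) • x - (2 : ℂ) • lengthOp n x) := by
  have : weakDown n ∘ₗ strongUp n = strongUp n ∘ₗ weakDown n +
      (((∑ i, rho n i : ℕ) : ℂ) • LinearMap.id - (2 : ℂ) • lengthOp n) := by
    refine Finsupp.lhom_ext' fun w => LinearMap.ext_ring ?_
    classical
    simp only [LinearMap.comp_apply, LinearMap.add_apply, LinearMap.sub_apply, LinearMap.smul_apply,
      LinearMap.id_apply, Finsupp.lsingle_apply, lengthOp_single]
    -- Both compositions are indexed by `k` and `v`, with endpoint `v s_k`, so that they can be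
    -- compared term by term.
    have h1 : weakDown n (strongUp n (Finsupp.single w 1)) = ∑ k : Fin (n - 1), ∑ v,
        (((if StrongCover w v ∧ v (hi k) < v (lo k) then codeDistance w v else 0 : ℤ) : ℂ) *
          ((k : ℂ) + 1)) • Finsupp.single (v * simpleTransposition k) 1 := by
      rw [strongUp_single, map_sum, Finset.sum_comm]
      refine Finset.sum_congr rfl fun v _ => ?_
      by_cases h : StrongCover w v
      · rw [if_pos h, map_smul, weakDown_single, Finset.smul_sum]
        refine Finset.sum_congr rfl fun k _ => ?_
        simp only [h, length_mul_simple_lt_iff, true_and]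
        split_ifs
        · rw [mul_smul]
        · simp
      · simp [h]
    have h2 : strongUp n (weakDown n (Finsupp.single w 1)) = ∑ k : Fin (n - 1), ∑ v,
        (((if w (hi k) < w (lo k) ∧
          StrongCover (w * simpleTransposition k) (v * simpleTransposition k) then
            codeDistance (w * simpleTransposition k) (v * simpleTransposition k) else 0 : ℤ) : ℂ) *
          ((k : ℂ) + 1)) • Finsupp.single (v * simpleTransposition k) 1 := by
      rw [weakDown_single, map_sum]
      refine Finset.sum_congr rfl fun k _ => ?_
      by_cases h : w (hi k) < w (lo k)
      · rw [if_pos (length_mul_simple_lt_iff.2 h), map_smul, strongUp_single, Finset.smul_sum,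
          ← Equiv.sum_comp (Equiv.mulRight (simpleTransposition k))]
        refine Finset.sum_congr rfl fun v _ => ?_
        by_cases hc : StrongCover (w * simpleTransposition k) (v * simpleTransposition k)
        · rw [if_pos (show StrongCover _ (Equiv.mulRight (simpleTransposition k) v) from hc), if_pos ⟨h, hc⟩, mul_comm,
            mul_smul]
          rfl
        · rw [if_neg (show ¬ StrongCover _ (Equiv.mulRight (simpleTransposition k) v) from hc),
            if_neg fun h' => hc h'.2]
          simp
      · rw [if_neg (fun h' => h (length_mul_simple_lt_iff.1 h')), map_zero]
        simp [h]
    have h3 : ∀ k : Fin (n - 1), ∑ v : Perm (Fin n), (((if v = w * simpleTransposition k then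
        2 * ((fullCode w (hi k) : ℤ) - fullCode w (lo k)) + 1 else 0 : ℤ) : ℂ) *
          ((k : ℂ) + 1)) • (Finsupp.single (v * simpleTransposition k) 1 : Perm (Fin n) →₀ ℂ) =
        (((2 * ((fullCode w (hi k) : ℤ) - fullCode w (lo k)) + 1 : ℤ) : ℂ) * ((k : ℂ) + 1)) •
          Finsupp.single w 1 := by
      intro k
      rw [Finset.sum_eq_single (w * simpleTransposition k)]
      · rw [if_pos rfl, mul_simpleTransposition_cancel]
      · intro v _ hv
        simp [hv]
      · simp
    have h4 : ∑ k : Fin (n - 1), ((2 * ((fullCode w (hi k) : ℤ) - fullCode w (lo k)) + 1) *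
        ((k : ℤ) + 1)) = (∑ i, rho n i : ℕ) - 2 * length w := by
      have e1 := sum_mul_fullCode w
      have e2 := sum_succ_eq_sum_sub n
      have : ∀ k : Fin (n - 1), ((2 * ((fullCode w (hi k) : ℤ) - fullCode w (lo k)) + 1) *
        ((k : ℤ) + 1)) = 2 * (((k : ℤ) + 1) * ((fullCode w (hi k) : ℤ) - fullCode w (lo k))) +
          ((k : ℤ) + 1) := fun k => by ring
      simp only [this, Finset.sum_add_distrib, ← Finset.mul_sum] at *
      rw [e1, e2]
      simp only [rho_apply]
      push_cast
      ring
    have h5 := congrArg (Int.cast : ℤ → ℂ) h4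
    push_cast at h5
    rw [h1, h2, smul_smul, ← sub_smul, Nat.cast_sum, ← h5, Finset.sum_smul,
      ← Finset.sum_add_distrib]
    refine Finset.sum_congr rfl fun k _ => ?_
    have h6 := h3 k
    push_cast at h6 ⊢
    rw [← h6, ← Finset.sum_add_distrib]
    refine Finset.sum_congr rfl fun v _ => ?_
    have h7 := congrArg (Int.cast : ℤ → ℂ) (up_down_term w v k)
    push_cast at h7
    rw [h7, add_mul, add_smul]
  exact LinearMap.congr_fun this x

/-- Schubert polynomials as a linear map. -/
noncomputable def schubertMap (n : ℕ) : (Perm (Fin n) →₀ ℂ) →ₗ[ℂ] MvPolynomial (Fin n) ℂ :=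
  Finsupp.linearCombination ℂ schubert

theorem schubertMap_single {n : ℕ} (w : Perm (Fin n)) :
    schubertMap n (Finsupp.single w 1) = schubert w := by
  rw [schubertMap, Finsupp.linearCombination_single, one_smul]

theorem nabla_schubertMap {n : ℕ} (x : Perm (Fin n) →₀ ℂ) :
    nabla n (schubertMap n x) = schubertMap n (weakDown n x) := by
  have : (nabla n).toLinearMap ∘ₗ schubertMap n = schubertMap n ∘ₗ weakDown n := by
    refine Finsupp.lhom_ext' fun w => LinearMap.ext_ring ?_
    classical
    simp only [LinearMap.comp_apply, Finsupp.lsingle_apply, schubertMap_single, weakDown_single,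
      map_sum, Derivation.coeFn_coe, nabla_schubert]
    refine Finset.sum_congr rfl fun k _ => ?_
    split_ifs
    · rw [map_smul, schubertMap_single]
    · rw [map_zero]
  exact LinearMap.congr_fun this x

theorem euler_schubertMap {n : ℕ} (x : Perm (Fin n) →₀ ℂ) :
    euler n (schubertMap n x) = schubertMap n (lengthOp n x) := by
  have : (euler n).toLinearMap ∘ₗ schubertMap n = schubertMap n ∘ₗ lengthOp n := by
    refine Finsupp.lhom_ext' fun w => LinearMap.ext_ring ?_
    simp only [LinearMap.comp_apply, Finsupp.lsingle_apply, schubertMap_single, lengthOp_single,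
      map_smul, Derivation.coeFn_coe, euler_schubert]
  exact LinearMap.congr_fun this x

theorem raising_schubertMap {n : ℕ} (x : Perm (Fin n) →₀ ℂ) :
    raising n (schubertMap n x) = schubertMap n (strongUp n x) := by
  refine raising_intertwines (raising n) (nabla n).toLinearMap (euler n).toLinearMap (strongUp n)
    (weakDown n) (lengthOp n) (schubertMap n) _ nabla_raising euler_raising weakDown_strongUp
    lengthOp_strongUp nabla_schubertMap euler_schubertMap (staircaseSpace n)
    (fun _ => raising_mem_staircaseSpace) (fun x => ?_) (∑ i, rho n i + 1) (fun Y hY hE => ?_) x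
  · rw [schubertMap, Finsupp.linearCombination_apply]
    exact Submodule.sum_mem _ fun w _ => Submodule.smul_mem _ _ (schubert_mem_staircaseSpace w)
  · refine Finsupp.lhom_ext' fun w => LinearMap.ext_ring ?_
    -- A map raising degree by `|ρ| + 1` sends `w` to degree above `|ρ|`, the top degree of the
    -- staircase span.
    refine eq_zero_of_euler_eq (d := length w + (∑ i, rho n i + 1)) (hY _) (by omega) ?_
    have := hE (Finsupp.single w 1)
    rw [lengthOp_single, map_smul, ← add_smul] at this
    rw [Nat.cast_add]
    exact this

open Classical in
theorem raising_schubert {n : ℕ} (w : Perm (Fin n)) : raising n (schubert w) =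
    ∑ v : Perm (Fin n), if StrongCover w v then (codeDistance w v : ℂ) • schubert v else 0 := by
  rw [← schubertMap_single, raising_schubertMap, strongUp_single, map_sum]
  refine Finset.sum_congr rfl fun v _ => ?_
  split_ifs
  · rw [map_smul, schubertMap_single]
  · rw [map_zero]

/-! ### Padding -/

theorem padding_monomial {n : ℕ} (a : Fin n →₀ ℕ) :
    padding n (monomial a 1) = paddedMonomial n fun i => a (lo i) := by
  have := (basisMonomials (Fin n) ℂ).constr_basis ℂ
    (fun α => paddedMonomial n fun i => α (lo i)) a
  rwa [coe_basisMonomials] at this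

theorem paddedMonomial_eq_monomial {n : ℕ} (α : Fin (n - 1) → ℕ) : paddedMonomial n α =
    monomial (Finsupp.equivFunOnFinite.symm (Sum.elim α fun i => staircase n i - α i)) 1 := by
  rw [monomial_eq, C_1, one_mul, Finsupp.prod_fintype _ _ fun _ => pow_zero _,
    Fintype.prod_sum_type, paddedMonomial, Finset.prod_mul_distrib]
  rfl

theorem Delta_paddedMonomial {n : ℕ} (α : Fin (n - 1) → ℕ) (h : α ≤ staircase n) :
    Delta n (paddedMonomial n α) = ∑ i, ((staircase n i : ℂ) - α i) •
      paddedMonomial n (α + Pi.single i 1) := by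
  simp only [Delta, LinearMap.sum_apply]
  refine Finset.sum_congr rfl fun i _ => ?_
  rw [LinearMap.comp_apply, LinearMap.mulLeft_apply, Derivation.coeFn_coe,
    paddedMonomial_eq_monomial, pderiv_monomial, X, monomial_mul]
  have hi : α i ≤ staircase n i := h i
  simp only [one_mul, Finsupp.equivFunOnFinite_symm_apply_apply, Sum.elim_inr, Nat.cast_sub hi]
  -- On the boundary `α i + 1` leaves the staircase and the exponent of `y_i` is truncated, but both
  -- coefficients are `0`.
  by_cases hz : α i = staircase n i
  · simp [hz]
  · rw [paddedMonomial_eq_monomial, smul_monomial, smul_eq_mul, mul_one]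
    refine congrArg (fun e => monomial e _) (Finsupp.ext ?_)
    rintro (j | j)
    · by_cases hj : j = i
      · subst hj; simp; omega
      · simp [hj]
    · by_cases hj : j = i
      · subst hj; simp; omega
      · simp [hj]

theorem le_staircase {n : ℕ} {a : Fin n →₀ ℕ} (ha : a ≤ rho n) :
    (fun i => a (lo i)) ≤ staircase n := fun i => ha (lo i)

theorem Delta_padding {n : ℕ} {f : MvPolynomial (Fin n) ℂ} (hf : f ∈ staircaseSpace n) :
    Delta n (padding n f) = padding n (raising n f) := by
  induction hf using Submodule.span_induction with
  | mem x hx =>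
    obtain ⟨a, ha, rfl⟩ := hx
    dsimp only
    rw [padding_monomial, Delta_paddedMonomial _ (le_staircase ha), raising_monomial, map_sum,
      ← sum_lo fun i : Fin n => padding n
        (((rho n i : ℂ) - a i) • monomial (a + Finsupp.single i 1) 1)]
    · refine Finset.sum_congr rfl fun i _ => ?_
      rw [map_smul, padding_monomial]
      congr 2
      funext j
      have : lo i = lo j ↔ j = i := by
        rw [Fin.ext_iff, Fin.ext_iff]; exact eq_comm
      simp [Finsupp.single_apply, Pi.single_apply, this]
    · intro i hi
      have h1 := ha i
      -- For the last variable, which has no padded counterpart, `ρ_i = a i = 0` and the term of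
      -- `raising` vanishes.
      have h2 : rho n i = 0 := by rw [rho_apply]; omega
      have h3 : a i = 0 := by omega
      rw [h2, h3, sub_self, zero_smul, map_zero]
  | zero => simp
  | add x y _ _ hx hy => simp only [map_add, hx, hy]
  | smul c x _ hx => simp only [map_smul, hx]

theorem padding_mem_paddedSpace {n : ℕ} {f : MvPolynomial (Fin n) ℂ} (hf : f ∈ staircaseSpace n) :
    padding n f ∈ paddedSpace n := by
  induction hf using Submodule.span_induction with
  | mem x hx =>
    obtain ⟨a, ha, rfl⟩ := hx
    exact Submodule.subset_span ⟨_, le_staircase ha, padding_monomial a⟩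
  | zero => simp
  | add x y _ _ hx hy => rw [map_add]; exact Submodule.add_mem _ hx hy
  | smul c x _ hx => rw [map_smul]; exact Submodule.smul_mem _ _ hx

/-- Setting all `y_i = 1` undoes the padding, which is therefore injective on the staircase span. -/
theorem aeval_padding {n : ℕ} {f : MvPolynomial (Fin n) ℂ} (hf : f ∈ staircaseSpace n) :
    aeval (Sum.elim (fun i => X (lo i)) fun _ => 1 : _ → MvPolynomial (Fin n) ℂ)
      (padding n f) = f := by
  induction hf using Submodule.span_induction with
  | mem x hx =>
    obtain ⟨a, ha, rfl⟩ := hx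
    dsimp only
    rw [padding_monomial, paddedMonomial, monomial_eq_prod, ← prod_lo fun i => X i ^ a i]
    · simp
    · intro i hi
      have h1 := ha i
      rw [rho_apply] at h1
      rw [show a i = 0 by omega, pow_zero]
  | zero => simp
  | add x y _ _ hx hy => simp only [map_add, hx, hy]
  | smul c x _ hx => simp only [map_smul, hx]

/-! ### The basis of `Ṽ` -/

theorem linearIndependent_paddedSchubert (n : ℕ) :
    LinearIndependent ℂ (paddedSchubert : Perm (Fin n) → XYPoly n) := by
  refine (linearIndependent_schubert n).map (f := padding n) ?_
  rw [Submodule.disjoint_def]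
  intro f hf h0
  have hf' : f ∈ staircaseSpace n := by
    refine Submodule.span_le.2 ?_ hf
    rintro _ ⟨w, rfl⟩
    exact schubert_mem_staircaseSpace w
  have h1 := aeval_padding hf'
  rw [LinearMap.mem_ker.1 h0, map_zero] at h1
  exact h1.symm

theorem paddedSpace_eq_span_range (n : ℕ) : paddedSpace n = Submodule.span ℂ (Set.range
    fun α : (i : Fin (n - 1)) → Fin (staircase n i + 1) => paddedMonomial n fun i => α i) := by
  rw [paddedSpace]
  congr 1
  ext f
  constructor
  · rintro ⟨α, hα, rfl⟩
    exact ⟨fun i => ⟨α i, Nat.lt_succ_of_le (hα i)⟩, rfl⟩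
  · rintro ⟨α, rfl⟩
    exact ⟨_, fun i => Nat.le_of_lt_succ (α i).2, rfl⟩

theorem prod_staircase_succ (n : ℕ) : ∏ i : Fin (n - 1), (staircase n i + 1) = n.factorial := by
  cases n with
  | zero => simp
  | succ m =>
    induction m with
    | zero => simp
    | succ m ih =>
      change ∏ i : Fin m, (m - (i : ℕ) + 1) = _ at ih
      change ∏ i : Fin (m + 1), (m + 1 - (i : ℕ) + 1) = _
      rw [Fin.prod_univ_succ, Nat.factorial_succ, ← ih]
      simp

/-- Dimension count: `n!` independent elements of a space spanned by `∏ (ρ_i + 1) = n!` monomials.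
-/
theorem span_paddedSchubert (n : ℕ) :
    Submodule.span ℂ (Set.range (paddedSchubert : Perm (Fin n) → XYPoly n)) = paddedSpace n := by
  have hfin : FiniteDimensional ℂ (paddedSpace n) := by
    rw [paddedSpace_eq_span_range]
    exact FiniteDimensional.span_of_finite ℂ (Set.finite_range _)
  refine Submodule.eq_of_le_of_finrank_le ?_ ?_
  · rw [Submodule.span_le]
    rintro _ ⟨w, rfl⟩
    exact padding_mem_paddedSpace (schubert_mem_staircaseSpace w)
  · rw [finrank_span_eq_card (linearIndependent_paddedSchubert n), Fintype.card_perm,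
      Fintype.card_fin, paddedSpace_eq_span_range]
    refine (finrank_range_le_card _).trans ?_
    simp [prod_staircase_succ]

end PaddedSchubert

open Classical in
theorem mainTheorem1 (n : ℕ) :
    LinearIndependent ℂ
        (PaddedSchubert.paddedSchubert : Equiv.Perm (Fin n) → PaddedSchubert.XYPoly n) ∧
      Submodule.span ℂ
        (Set.range (PaddedSchubert.paddedSchubert : Equiv.Perm (Fin n) → PaddedSchubert.XYPoly n))
          = PaddedSchubert.paddedSpace n ∧
      ∀ w : Equiv.Perm (Fin n),
        PaddedSchubert.Delta n (PaddedSchubert.paddedSchubert w) =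
          ∑ u ∈ Finset.univ.filter
              (fun u : Equiv.Perm (Fin n) => PaddedSchubert.StrongCover w (w * u)),
            (PaddedSchubert.codeDistance w (w * u) : ℂ) •
              PaddedSchubert.paddedSchubert (w * u) := by
  refine ⟨PaddedSchubert.linearIndependent_paddedSchubert n, PaddedSchubert.span_paddedSchubert n,
    fun w => ?_⟩
  rw [PaddedSchubert.paddedSchubert,
    PaddedSchubert.Delta_padding (PaddedSchubert.schubert_mem_staircaseSpace w),
    PaddedSchubert.raising_schubert, map_sum, Finset.sum_filter,
    ← Equiv.sum_comp (Equiv.mulLeft w)]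
  refine Finset.sum_congr rfl fun u _ => ?_
  rw [Equiv.coe_mulLeft]
  split_ifs
  · rw [map_smul, PaddedSchubert.paddedSchubert]
  · rw [map_zero]
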